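/- **Conventions.** A tableau is a filling of the boxes of a skew shape by positive integers; it is *decreasing* (resp. *increasing*) if its entries strictly decrease (resp. strictly increase) along rows from left to right and along columns from top to bottom. Columns are identified with their sets of entries, and $\mathrm{word}(T)$ is the word obtained by reading the columns of $T$ from left to right, each from bottom to top. For a finite set $S$ of positive integers and a letter $m$, let $S\star m=(S\setminus\{m'\})\cup\{m\}$, where $m'$ is the smallest element of $S$ that is at least $m$, and $S\star m=S\cup\{m\}$ if there is no such $m'$; for a word put $S\star w_1\cdots w_n=(\cdots(S\star w_1)\star\cdots)\star w_n$. For a tableau $T$ of partition shape, $T_{\ge j}$ is $T$ with its first $j-1$ columns removed, and the *right key* $K_+(T)$ is the filling whose $j$-th column consists of the elements of $\emptyset\star\mathrm{word}(T_{\ge j})$, decreasing from top to bottom. A *key tableau* is a tableau of partition shape, weakly decreasing along rows and strictly decreasing down columns, in which each column contains the next one as a set. *K-jeu-de-taquin.* A rook strip is a skew shape with at most one box in each row and in each column. If $D=\mu/\nu$ and $E=\rho/\mu$ are rook strips, their switch $(E',D')$ is given by $E'\cup D'=D\cup E$, where $E'$ consists of the boxes of $D$ that are not isolated in $D\cup E$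 and the boxes of $E$ that are isolated there, and $D'$ consists of the remaining boxes. A decreasing tableau $T$ is a sequence of successive rook strips $D_1,\dots,D_n$ (the boxes with equal entries, from the largest entry to the smallest), and it slides into a rook strip $E$ that extends its shape by switching $E$ past $D_n,\dots,D_1$, in this order; the strips keep their entries. For an increasing tableau $U$ whose shape extends that of $T$, $J^{\searrow}_U(T)$ is obtained by sliding $T$ successively into the strips of boxes with equal entries of $U$, from the smallest entry to the largest. A skew shape is *antinormal* if it is empty or has a unique southeast corner. A *Kjdt anti-rectification* of $T$ is any $J^{\searrow}_U(T)$ of antinormal shape; the increasing tableau $U$ is its *rectification order*. *Reverse Hecke column insertion* with $\alpha=1$ at a box $c$ of a decreasing tableau $P$ of partition shape, where $c$ is the last box of its row and of its column: remove $c$, let $y$ be its entry, and reverse insert $y$ into the column to the left. To reverse insert $y$ into a column, find the smallest entry $y'>y$ of that column, replace $y'$ by $y$ if the result is a decreasing tableau, leave the column unchanged otherwise, and in both cases reverse insert $y'$ into the next column to the left. The value left over after the first column is the output. **Proposition.** Let $T$ be a decreasing tableau of partition shape $\lambda$. 1. The rightmost column of every Kjdt anti-rectification of $T$, for an arbitrary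 rectification order, equals $\emptyset\star\mathrm{word}(T)$; in particular it does not depend on the rectification order. If $R$ is the smallest rectangle containing $\lambda$, then every increasing tableau $U$ of shape $R/\lambda$ is a rectification order of an anti-rectification of $T$, that is, $J^{\searrow}_U(T)$ has antinormal shape. 2. The right key $K_+(T)$ is a key tableau, and for every $j\ge1$ the following are equal to its $j$-th column: (i) $\emptyset\star\mathrm{word}(T_{\ge j})$; (ii) the rightmost column of any Kjdt anti-rectification of $T_{\ge j}$, for an arbitrary rectification order; (iii) the set of output numbers of the following procedure: let $m$ be the number of boxes in column $j$ of $T$, and apply to the conjugate (transpose) of $T_{\ge j}$ the reverse Hecke column insertion with $\alpha=1$ at the end of column $m$, then, to the resulting tableau, at the end of column $m-1$, and so on down to column $1$. -/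

import Mathlib

/-- A filling of a finite set of boxes by natural numbers.  A box is a pair `(row, column)`,
both counted from `0`, rows from top to bottom and columns from left to right.
The values of `entry` outside `cells` are irrelevant. -/
structure Filling where
  /-- the set of boxes -/
  cells : Finset (ℕ × ℕ)
  /-- the number in a box -/
  entry : ℕ × ℕ → ℕ

namespace Filling

/-! ### Shapes -/

/-- `D` is a skew shape `μ/ν`. -/
def IsSkewShape (D : Finset (ℕ × ℕ)) : Prop :=
  ∃ ν μ : YoungDiagram, ν ≤ μ ∧ D = μ.cells \ ν.cells

/-- The skew shapes `D = μ/ν` and `E = ρ/μ` are successive (`E` extends `D`). -/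
def Successive (D E : Finset (ℕ × ℕ)) : Prop :=
  ∃ ν μ ρ : YoungDiagram, ν ≤ μ ∧ μ ≤ ρ ∧ D = μ.cells \ ν.cells ∧ E = ρ.cells \ μ.cells

/-- A southeast corner of `D`: a box of `D` with no box of `D` directly below it or directly to
its right. -/
def IsSECorner (D : Finset (ℕ × ℕ)) (b : ℕ × ℕ) : Prop :=
  b ∈ D ∧ (b.1 + 1, b.2) ∉ D ∧ (b.1, b.2 + 1) ∉ D

/-- A skew shape is antinormal if it is empty or has a unique southeast corner. -/
def IsAntinormal (D : Finset (ℕ × ℕ)) : Prop :=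
  IsSkewShape D ∧ (D = ∅ ∨ ∃! b, IsSECorner D b)

/-- The smallest rectangle with northwest corner `(0, 0)` that contains `D`. -/
def boundingRectangle (D : Finset (ℕ × ℕ)) : Finset (ℕ × ℕ) :=
  Finset.range (D.sup fun b => b.1 + 1) ×ˢ Finset.range (D.sup fun b => b.2 + 1)

/-- The boxes of `T` form the Young diagram of a partition. -/
def HasPartitionShape (T : Filling) : Prop :=
  ∃ μ : YoungDiagram, T.cells = μ.cells

/-! ### Tableaux -/

/-- The entries are positive and strictly decrease along rows (left to right) and along columns
(top to bottom). -/
def IsDecreasing (T : Filling) : Prop :=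
  (∀ a ∈ T.cells, 0 < T.entry a) ∧
  (∀ a ∈ T.cells, ∀ b ∈ T.cells, a.1 = b.1 → a.2 < b.2 → T.entry b < T.entry a) ∧
  (∀ a ∈ T.cells, ∀ b ∈ T.cells, a.2 = b.2 → a.1 < b.1 → T.entry b < T.entry a)

instance (T : Filling) : Decidable T.IsDecreasing := by
  unfold IsDecreasing; infer_instance

/-- The entries are positive and strictly increase along rows and along columns. -/
def IsIncreasing (T : Filling) : Prop :=
  (∀ a ∈ T.cells, 0 < T.entry a) ∧
  (∀ a ∈ T.cells, ∀ b ∈ T.cells, a.1 = b.1 → a.2 < b.2 → T.entry a < T.entry b) ∧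
  (∀ a ∈ T.cells, ∀ b ∈ T.cells, a.2 = b.2 → a.1 < b.1 → T.entry a < T.entry b)

/-- Reverse semistandard: the entries are positive, weakly decrease along rows and strictly
decrease along columns. -/
def IsReverseSemistandard (T : Filling) : Prop :=
  (∀ a ∈ T.cells, 0 < T.entry a) ∧
  (∀ a ∈ T.cells, ∀ b ∈ T.cells, a.1 = b.1 → a.2 < b.2 → T.entry b ≤ T.entry a) ∧
  (∀ a ∈ T.cells, ∀ b ∈ T.cells, a.2 = b.2 → a.1 < b.1 → T.entry b < T.entry a)

/-- The boxes in column `j`. -/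
def columnCells (T : Filling) (j : ℕ) : Finset (ℕ × ℕ) :=
  T.cells.filter fun b => b.2 = j

/-- Column `j`, as the set of its entries. -/
def column (T : Filling) (j : ℕ) : Finset ℕ :=
  (T.columnCells j).image T.entry

/-- The set of entries of the rightmost column (`∅` for the empty filling). -/
def rightmostColumn (T : Filling) : Finset ℕ :=
  T.column (T.cells.sup Prod.snd)

/-- A key tableau, written as a reverse semistandard tableau of partition shape: each column
contains the next one as a set. -/
def IsKey (T : Filling) : Prop :=
  T.HasPartitionShape ∧ T.IsReverseSemistandard ∧ ∀ j, T.column (j + 1) ⊆ T.column j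

/-- The filling obtained by removing the first `j` columns (the rest is moved to the left). -/
def dropColumns (T : Filling) (j : ℕ) : Filling where
  cells := (T.cells.filter fun b => j ≤ b.2).image fun b => (b.1, b.2 - j)
  entry b := T.entry (b.1, b.2 + j)

/-- The conjugate (transposed) filling. -/
def conjugate (T : Filling) : Filling where
  cells := T.cells.image Prod.swap
  entry b := T.entry b.swap

/-- The word of column `j`, read from bottom to top. -/
def columnWord (T : Filling) (j : ℕ) : List ℕ :=
  ((List.range (T.cells.sup Prod.fst + 1)).reverse.filter fun i => (i, j) ∈ T.cells).map
    fun i => T.entry (i, j)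

/-- The column reading word: columns from left to right, each read from bottom to top. -/
def word (T : Filling) : List ℕ :=
  (List.range (T.cells.sup Prod.snd + 1)).flatMap T.columnWord

/-! ### The star action and the right key -/

/-- `S ⋆ m`: the smallest element of `S` that is at least `m`, if there is one, is removed, and
`m` is put in. -/
def starLetter (S : Finset ℕ) (m : ℕ) : Finset ℕ :=
  if h : (S.filter fun x => m ≤ x).Nonempty then
    insert m (S.erase ((S.filter fun x => m ≤ x).min' h))
  else insert m S

/-- `S ⋆ w` for a word `w`. -/
def star (S : Finset ℕ) (w : List ℕ) : Finset ℕ :=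
  w.foldl starLetter S

/-- The right key of `T`: its column `j` consists of the elements of `∅ ⋆ word(T')`, in decreasing
order from top to bottom, where `T'` is `T` without the columns to the left of column `j`. -/
def rightKey (T : Filling) : Filling where
  cells := (Finset.range (T.cells.sup Prod.snd + 1)).biUnion fun j =>
    (Finset.range (star ∅ (T.dropColumns j).word).card).image fun i => (i, j)
  entry b := ((star ∅ (T.dropColumns b.2).word).sort (· ≥ ·)).getD b.1 0

/-! ### K-theoretic jeu de taquin -/

/-- A box is isolated in `D` if none of its four neighbours is in `D`. -/
def IsIsolated (D : Finset (ℕ × ℕ)) (b : ℕ × ℕ) : Prop :=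
  (b.1 + 1, b.2) ∉ D ∧ (b.1, b.2 + 1) ∉ D ∧
    ∀ c ∈ D, (c.1 + 1, c.2) ≠ b ∧ (c.1, c.2 + 1) ≠ b

instance (D : Finset (ℕ × ℕ)) (b : ℕ × ℕ) : Decidable (IsIsolated D b) := by
  unfold IsIsolated; infer_instance

/-- The switch `(E', D')` of two successive rook strips `(D, E)`: we have
`E' ∪ D' = D ∪ E`, the isolated boxes of `D` lie in `D'`, those of `E` lie in `E'`, and a box
that is not isolated in `D ∪ E` changes its type (the inner box of two adjacent boxes was in `D`
and is in `E'`). -/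
def switch (D E : Finset (ℕ × ℕ)) : Finset (ℕ × ℕ) × Finset (ℕ × ℕ) :=
  (D.filter (fun b => ¬ IsIsolated (D ∪ E) b) ∪ E.filter (fun b => IsIsolated (D ∪ E) b),
   E.filter (fun b => ¬ IsIsolated (D ∪ E) b) ∪ D.filter (fun b => IsIsolated (D ∪ E) b))

/-- The boxes with entry `v`. -/
def strip (T : Filling) (v : ℕ) : Finset (ℕ × ℕ) :=
  T.cells.filter fun b => T.entry b = v

/-- The largest entry (`0` for the empty filling). -/
def maxEntry (T : Filling) : ℕ :=
  T.cells.sup T.entry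

/-- One step of the forward slide: the rook strip `p.2` is switched past the boxes with
entry `v` of the filling `p.1`. -/
def slideStep (p : Filling × Finset (ℕ × ℕ)) (v : ℕ) : Filling × Finset (ℕ × ℕ) :=
  let s := switch (p.1.strip v) p.2
  ({ cells := (p.1.cells \ p.1.strip v) ∪ s.2
     entry := fun b => if b ∈ s.2 then v else p.1.entry b }, s.1)

/-- The forward slide of a decreasing tableau `T` into a rook strip `E` that extends its shape:
`E` is switched past all the strips of `T`, from the outermost one (smallest entry) to the
innermost one (largest entry). -/
def slide (T : Filling) (E : Finset (ℕ × ℕ)) : Filling :=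
  ((List.range (T.maxEntry + 1)).foldl slideStep (T, E)).1

/-- The forward K-jeu-de-taquin of a decreasing tableau `T` along an increasing tableau `U` whose
shape extends that of `T`: `T` slides into the rook strips of `U`, in increasing order. -/
def kjdt (U T : Filling) : Filling :=
  (List.range (U.maxEntry + 1)).foldl (fun S a => S.slide (U.strip a)) T

/-- `T'` is a K-jeu-de-taquin anti-rectification of `T`: it has antinormal shape and is
obtained from `T` by forward K-jeu-de-taquin along some rectification order `U`. -/
def IsAntirectification (T T' : Filling) : Prop :=
  IsAntinormal T'.cells ∧
    ∃ U : Filling, U.IsIncreasing ∧ Successive T.cells U.cells ∧ T' = kjdt U T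

/-! ### Reverse Hecke column insertion -/

/-- Reverse insertion of `y` into columns `k - 1, ..., 0`: in each column the smallest `y' > y`
is located, it is replaced by `y` if the result is a decreasing tableau, and `y'` is reverse
inserted into the previous column.  The result is the final tableau with the final value.
(If no `y' > y` exists, which does not happen for the insertions considered here, the column is
skipped.) -/
def reverseInsert : ℕ → ℕ → Filling → Filling × ℕ
  | 0, y, P => (P, y)
  | k + 1, y, P =>
    if h : ((P.column k).filter fun x => y < x).Nonempty then
      let y' := ((P.column k).filter fun x => y < x).min' h
      let Q : Filling :=
        { cells := P.cells
          entry := fun b => if b.2 = k ∧ P.entry b = y' then y else P.entry b }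
      reverseInsert k y' (if Q.IsDecreasing then Q else P)
    else reverseInsert k y P

/-- Reverse Hecke column insertion at the box `c`, which is at the end of its row and of its
column.  The box is removed if `α = true` (that is, `α = 1`) and kept otherwise. -/
def reverseHecke (P : Filling) (c : ℕ × ℕ) (α : Bool) : Filling × ℕ :=
  reverseInsert c.2 (P.entry c)
    (if α then { cells := P.cells.erase c, entry := P.entry } else P)

/-- The lowest box of column `k`. -/
def bottomBox (P : Filling) (k : ℕ) : ℕ × ℕ :=
  ((P.columnCells k).sup Prod.fst, k)

/-- The outputs of the reverse Hecke column insertions, with `α = 1`, at the ends of the first `m`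
columns, from the last of these columns to the first one; each insertion is applied to the
tableau that the previous one has produced. -/
def reverseHeckeOutputs : ℕ → Filling → List ℕ
  | 0, _ => []
  | m + 1, P =>
    let r := reverseHecke P (bottomBox P m) true
    r.2 :: reverseHeckeOutputs m r.1

end Filling

/-! The set `∅ ⋆ w` is governed by increasing subsequences: the number of its elements below `t` is
the greatest length of a strictly increasing subsequence of `w` with letters below `t`
(`length_le_countBelow_star`, `exists_sublist_length_eq_countBelow_star`). Hence `∅ ⋆ u = ∅ ⋆ w` as
soon as every increasing subsequence of either word can be traded for one of the other word, of the
same length and not exceeding its largest letter. If the new letters also stay above the smallest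
old one, the relation respects concatenation (`WordEquiv`), so it can be checked on neighbouring
columns.

Slides. Let `T'` be the slide of `T` into a rook strip. Every entry of `T` reappears in its box or
in the next box down or right, and every entry of `T'` arises in this way. Replace the columns of
`T'` by those of `T` one at a time, from the left. The exchanged column `m` stands between column `m
- 1` of `T` and column `m + 1` of `T'`. A letter that only `T` has in column `m` has a copy in the
right neighbour; a letter that only `T'` has there has a copy in the left neighbour. So both
versions can be cut down to their intersection (`wordEquiv_right`, `wordEquiv_left`), and `∅ ⋆ word`
is invariant. In an antinormal tableau the rightmost column ends the word, so its letters survive,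
and it meets every nonempty row; since an increasing subsequence uses each row at most once, no
other element fits (`rightmostColumn_eq_star`).

Keys. The columns of the right key are nested because `S ⋆ w` is monotone in `S`.

Reverse insertion. For partition shape the word may be read by rows instead of columns
(`star_rowsList`), that is, by columns of the conjugate, from the last one to the first. Reverse
insertion carries a letter through these columns to the end of the word without leaving its class
(`reverseInsert_spec`). Successive outputs decrease (`CanReverse.snd_lt`), so they form an
increasing suffix and survive; there are as many of them as rows, and `∅ ⋆ word` is no larger. -/

namespace Filling

/-! ### Counting functions and the star action -/

/-- The number of elements of `S` below `t`. -/
def countBelow (S : Finset ℕ) (t : ℕ) : ℕ := (S.filter (· < t)).card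

theorem countBelow_mono (S : Finset ℕ) {s t : ℕ} (h : s ≤ t) : countBelow S s ≤ countBelow S t := by
  refine Finset.card_le_card fun x hx => ?_
  simp only [Finset.mem_filter] at hx ⊢
  exact ⟨hx.1, hx.2.trans_le h⟩

theorem countBelow_succ_of_mem {S : Finset ℕ} {x : ℕ} (h : x ∈ S) :
    countBelow S (x + 1) = countBelow S x + 1 := by
  have : S.filter (· < x + 1) = insert x (S.filter (· < x)) := by
    ext y; simp only [Finset.mem_filter, Finset.mem_insert]
    constructor
    · rintro ⟨h1, h2⟩
      by_cases h3 : y = x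
      · exact Or.inl h3
      · exact Or.inr ⟨h1, by omega⟩
    · rintro (rfl | ⟨h1, h2⟩)
      · exact ⟨h, by omega⟩
      · exact ⟨h1, by omega⟩
  rw [countBelow, this, Finset.card_insert_of_notMem (by simp), countBelow]

theorem countBelow_succ_of_notMem {S : Finset ℕ} {x : ℕ} (h : x ∉ S) :
    countBelow S (x + 1) = countBelow S x := by
  unfold countBelow
  congr 1
  ext y; simp only [Finset.mem_filter]
  constructor
  · rintro ⟨h1, h2⟩
    refine ⟨h1, ?_⟩
    have : y ≠ x := fun e => h (e ▸ h1)
    omega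
  · rintro ⟨h1, h2⟩
    exact ⟨h1, by omega⟩

theorem eq_of_countBelow_eq {S S' : Finset ℕ} (h : ∀ t, countBelow S t = countBelow S' t) :
    S = S' := by
  ext x
  by_cases h1 : x ∈ S <;> by_cases h2 : x ∈ S'
  · simp [h1, h2]
  · have := countBelow_succ_of_mem h1
    have := countBelow_succ_of_notMem h2
    have := h x
    have := h (x + 1)
    omega
  · have := countBelow_succ_of_mem h2
    have := countBelow_succ_of_notMem h1
    have := h x
    have := h (x + 1)
    omega
  · simp [h1, h2]

theorem exists_countBelow_eq_card (S : Finset ℕ) : ∃ t, countBelow S t = S.card := by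
  refine ⟨S.sup id + 1, ?_⟩
  unfold countBelow
  congr 1
  refine Finset.filter_true_of_mem fun x hx => ?_
  exact Nat.lt_succ_of_le (Finset.le_sup (f := id) hx)

theorem countBelow_eq_of_forall {S : Finset ℕ} {s t : ℕ} (hst : s ≤ t)
    (h : ∀ x ∈ S, s ≤ x → t ≤ x) : countBelow S t = countBelow S s := by
  unfold countBelow
  congr 1
  ext y; simp only [Finset.mem_filter]
  constructor
  · rintro ⟨h1, h2⟩
    refine ⟨h1, ?_⟩
    by_contra h3
    have := h y h1 (by omega)
    omega
  · rintro ⟨h1, h2⟩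
    exact ⟨h1, by omega⟩

theorem countBelow_insert {S : Finset ℕ} {m t : ℕ} (hm : m ∉ S) :
    countBelow (insert m S) t = if m < t then countBelow S t + 1 else countBelow S t := by
  unfold countBelow
  rw [Finset.filter_insert]
  split_ifs with h
  · rw [Finset.card_insert_of_notMem (by simp [hm])]
  · rfl

theorem countBelow_erase {S : Finset ℕ} {m t : ℕ} (hm : m ∈ S) :
    countBelow S t = if m < t then countBelow (S.erase m) t + 1 else countBelow (S.erase m) t := by
  conv_lhs => rw [← Finset.insert_erase hm]
  exact countBelow_insert (by simp)

/-- Putting in `m` and removing `m'` raises the count by one exactly for `m < t ≤ m'`, where `S` has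
as many elements below `t` as below `m`; for `t > m'` the count already exceeds the one at `m`. The
maximum covers both cases, and also the case without `m'`. This is the recursion satisfied by
longest increasing subsequences. -/
theorem countBelow_starLetter (S : Finset ℕ) (m t : ℕ) :
    countBelow (starLetter S m) t =
      if m < t then max (countBelow S t) (countBelow S m + 1) else countBelow S t := by
  unfold starLetter
  split_ifs with h hmt hmt
  · set m' := (S.filter fun x => m ≤ x).min' h with hm'
    have hmem := Finset.min'_mem _ h
    rw [← hm', Finset.mem_filter] at hmem
    have hmin : ∀ x ∈ S, m ≤ x → m' ≤ x := fun x hx hxm =>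
      Finset.min'_le _ _ (by simp [hx, hxm])
    have hnot : m ∉ S.erase m' := by
      intro h1
      rw [Finset.mem_erase] at h1
      have := hmin m h1.2 le_rfl
      omega
    have e := countBelow_erase (t := t) hmem.1
    rw [countBelow_insert hnot, if_pos hmt]
    by_cases h2 : m' < t
    · rw [if_pos h2] at e
      have h4 := countBelow_succ_of_mem hmem.1
      have h5 := countBelow_mono S (s := m' + 1) (t := t) h2
      have h6 := countBelow_mono S hmem.2
      omega
    · rw [if_neg h2] at e
      have h3 : countBelow S t = countBelow S m :=
        countBelow_eq_of_forall hmt.le fun x hx hxm => (by omega : t ≤ m').trans (hmin x hx hxm)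
      omega
  · set m' := (S.filter fun x => m ≤ x).min' h with hm'
    have hmem := Finset.min'_mem _ h
    rw [← hm', Finset.mem_filter] at hmem
    have hmin : ∀ x ∈ S, m ≤ x → m' ≤ x := fun x hx hxm =>
      Finset.min'_le _ _ (by simp [hx, hxm])
    have hnot : m ∉ S.erase m' := by
      intro h1
      rw [Finset.mem_erase] at h1
      have := hmin m h1.2 le_rfl
      omega
    have e := countBelow_erase (t := t) hmem.1
    rw [countBelow_insert hnot, if_neg hmt]
    rw [if_neg (by omega)] at e
    exact e.symm
  · have hall : ∀ x ∈ S, x < m := fun x hx => by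
      by_contra h1
      exact h ⟨x, by simp [hx]; omega⟩
    have hnot : m ∉ S := fun h1 => lt_irrefl _ (hall m h1)
    rw [countBelow_insert hnot, if_pos hmt]
    have h3 : countBelow S t = countBelow S m :=
        countBelow_eq_of_forall hmt.le fun x hx hxm => by have := hall x hx; omega
    omega
  · have hall : ∀ x ∈ S, x < m := fun x hx => by
      by_contra h1
      exact h ⟨x, by simp [hx]; omega⟩
    have hnot : m ∉ S := fun h1 => lt_irrefl _ (hall m h1)
    rw [countBelow_insert hnot, if_neg hmt]

/-! ### Increasing subsequences and domination of words -/

theorem star_append (S : Finset ℕ) (u w : List ℕ) : star S (u ++ w) = star (star S u) w :=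
  List.foldl_append

theorem star_concat (S : Finset ℕ) (u : List ℕ) (m : ℕ) :
    star S (u ++ [m]) = starLetter (star S u) m := by
  rw [star_append]; rfl

/-- An increasing subsequence of `w` with entries below `t` has at most as many letters as there
are elements of `∅ ⋆ w` below `t`. -/
theorem length_le_countBelow_star (w : List ℕ) : ∀ (t : ℕ) (l : List ℕ), l.Sublist w →
    l.Pairwise (· < ·) → (∀ a ∈ l, a < t) → l.length ≤ countBelow (star ∅ w) t := by
  induction w using List.reverseRecOn with
  | nil =>
    intro t l hl _ _
    rw [List.sublist_nil] at hl
    simp [hl]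
  | append_singleton w m ih =>
    intro t l hl hs ht
    rw [List.sublist_append_iff] at hl
    obtain ⟨l1, l2, rfl, h1, h2⟩ := hl
    rw [star_concat, countBelow_starLetter]
    rw [List.pairwise_append] at hs
    rcases List.sublist_singleton.1 h2 with rfl | rfl
    · have := ih t l1 h1 hs.1 (fun a ha => ht a (by simp [ha]))
      simp only [List.append_nil]
      split_ifs <;> omega
    · have hm : m < t := ht m (by simp)
      have := ih m l1 h1 hs.1 (fun a ha => hs.2.2 a ha m (by simp))
      rw [if_pos hm]
      simp only [List.length_append, List.length_singleton]
      omega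

/-- The bound of `length_le_countBelow_star` is attained. The two terms of the maximum in
`countBelow_starLetter` correspond to subsequences that avoid the last letter `m` and to those that
end with it. -/
theorem exists_sublist_length_eq_countBelow_star (w : List ℕ) : ∀ t : ℕ, ∃ l : List ℕ,
    l.Sublist w ∧ l.Pairwise (· < ·) ∧ (∀ a ∈ l, a < t) ∧
      l.length = countBelow (star ∅ w) t := by
  induction w using List.reverseRecOn with
  | nil => exact fun t => ⟨[], by simp, by simp, by simp, by simp [star, countBelow]⟩
  | append_singleton w m ih =>
    intro t
    rw [star_concat, countBelow_starLetter]
    obtain ⟨l, h1, h2, h3, h4⟩ := ih t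
    by_cases hm : m < t
    · rw [if_pos hm]
      rcases le_total (countBelow (star ∅ w) m + 1) (countBelow (star ∅ w) t) with h | h
      · exact ⟨l, h1.trans (List.sublist_append_left _ _), h2, h3, by rw [max_eq_left h, h4]⟩
      · obtain ⟨l', h1', h2', h3', h4'⟩ := ih m
        refine ⟨l' ++ [m], h1'.append (List.Sublist.refl _), ?_, ?_, ?_⟩
        · rw [List.pairwise_append]
          exact ⟨h2', by simp, by simpa using h3'⟩
        · intro a ha
          rcases List.mem_append.1 ha with ha | ha
          · exact (h3' a ha).trans hm
          · simp only [List.mem_singleton] at ha; omega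
        · rw [max_eq_right h, ← h4']; simp
    · rw [if_neg hm]
      exact ⟨l, h1.trans (List.sublist_append_left _ _), h2, h3, h4⟩

/-- Every increasing subsequence of `u` is matched by an increasing subsequence of `w` of the same
length whose entries are bounded by those of the given one. -/
def WeaklyDominated (u w : List ℕ) : Prop :=
  ∀ l : List ℕ, l.Sublist u → l.Pairwise (· < ·) → ∃ l' : List ℕ, l'.Sublist w ∧
    l'.Pairwise (· < ·) ∧ l'.length = l.length ∧ ∀ a ∈ l', ∃ b ∈ l, a ≤ b

/-- Every increasing subsequence of `u` is matched by an increasing subsequence of `w` of the same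
length whose entries lie between the extreme entries of the given one. -/
def Dominated (u w : List ℕ) : Prop :=
  ∀ l : List ℕ, l.Sublist u → l.Pairwise (· < ·) → ∃ l' : List ℕ, l'.Sublist w ∧
    l'.Pairwise (· < ·) ∧ l'.length = l.length ∧ ∀ a ∈ l', (∃ b ∈ l, b ≤ a) ∧ ∃ b ∈ l, a ≤ b

theorem Dominated.weaklyDominated {u w : List ℕ} (h : Dominated u w) : WeaklyDominated u w := by
  intro l h1 h2
  obtain ⟨l', h3, h4, h5, h6⟩ := h l h1 h2
  exact ⟨l', h3, h4, h5, fun a ha => (h6 a ha).2⟩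

theorem WeaklyDominated.countBelow_le {u w : List ℕ} (h : WeaklyDominated u w) (t : ℕ) :
    countBelow (star ∅ u) t ≤ countBelow (star ∅ w) t := by
  obtain ⟨l, h1, h2, h3, h4⟩ := exists_sublist_length_eq_countBelow_star u t
  obtain ⟨l', h5, h6, h7, h8⟩ := h l h1 h2
  rw [← h4, ← h7]
  refine length_le_countBelow_star w t l' h5 h6 fun a ha => ?_
  obtain ⟨b, hb, hab⟩ := h8 a ha
  exact hab.trans_lt (h3 b hb)

theorem star_eq_of_weaklyDominated {u w : List ℕ} (h : WeaklyDominated u w)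
    (h' : WeaklyDominated w u) : star ∅ u = star ∅ w :=
  eq_of_countBelow_eq fun t => le_antisymm (h.countBelow_le t) (h'.countBelow_le t)

theorem Dominated.of_sublist {u w : List ℕ} (h : u.Sublist w) : Dominated u w :=
  fun l h1 h2 => ⟨l, h1.trans h, h2, rfl, fun a ha => ⟨⟨a, ha, le_rfl⟩, a, ha, le_rfl⟩⟩

theorem Dominated.refl (u : List ℕ) : Dominated u u := .of_sublist (.refl u)

theorem Dominated.trans {u v w : List ℕ} (h : Dominated u v) (h' : Dominated v w) :
    Dominated u w := by
  intro l h1 h2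
  obtain ⟨l', h3, h4, h5, h6⟩ := h l h1 h2
  obtain ⟨m, h7, h8, h9, h10⟩ := h' l' h3 h4
  refine ⟨m, h7, h8, h9.trans h5, fun a ha => ?_⟩
  obtain ⟨⟨b, hb, hba⟩, c, hc, hac⟩ := h10 a ha
  obtain ⟨b', hb', hbb⟩ := (h6 b hb).1
  obtain ⟨c', hc', hcc⟩ := (h6 c hc).2
  exact ⟨⟨b', hb', hbb.trans hba⟩, c', hc', hac.trans hcc⟩

/-- Here the lower bounds are needed: the first part stays below its old maximum and the second
above its old minimum, so the glued sequence is still increasing. -/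
theorem Dominated.append {u w u' w' : List ℕ} (h : Dominated u w) (h' : Dominated u' w') :
    Dominated (u ++ u') (w ++ w') := by
  intro l h1 h2
  rw [List.sublist_append_iff] at h1
  obtain ⟨l1, l2, rfl, h3, h4⟩ := h1
  rw [List.pairwise_append] at h2
  obtain ⟨m1, a1, a2, a3, a4⟩ := h l1 h3 h2.1
  obtain ⟨m2, b1, b2, b3, b4⟩ := h' l2 h4 h2.2.1
  refine ⟨m1 ++ m2, a1.append b1, ?_, by simp [a3, b3], ?_⟩
  · rw [List.pairwise_append]
    refine ⟨a2, b2, fun a ha b hb => ?_⟩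
    obtain ⟨c, hc, hac⟩ := (a4 a ha).2
    obtain ⟨d, hd, hdb⟩ := (b4 b hb).1
    exact hac.trans_lt ((h2.2.2 c hc d hd).trans_le hdb)
  · intro a ha
    rcases List.mem_append.1 ha with ha | ha
    · obtain ⟨⟨b, hb, hb'⟩, c, hc, hc'⟩ := a4 a ha
      exact ⟨⟨b, by simp [hb], hb'⟩, c, by simp [hc], hc'⟩
    · obtain ⟨⟨b, hb, hb'⟩, c, hc, hc'⟩ := b4 a ha
      exact ⟨⟨b, by simp [hb], hb'⟩, c, by simp [hc], hc'⟩

/-- Mutual domination of words. -/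
def WordEquiv (u w : List ℕ) : Prop := Dominated u w ∧ Dominated w u

theorem WordEquiv.refl (u : List ℕ) : WordEquiv u u := ⟨.refl u, .refl u⟩
theorem WordEquiv.symm {u w : List ℕ} (h : WordEquiv u w) : WordEquiv w u := ⟨h.2, h.1⟩
theorem WordEquiv.trans {u v w : List ℕ} (h : WordEquiv u v) (h' : WordEquiv v w) :
    WordEquiv u w := ⟨h.1.trans h'.1, h'.2.trans h.2⟩
theorem WordEquiv.append {u w u' w' : List ℕ} (h : WordEquiv u w) (h' : WordEquiv u' w') :
    WordEquiv (u ++ u') (w ++ w') := ⟨h.1.append h'.1, h.2.append h'.2⟩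
theorem WordEquiv.star_eq {u w : List ℕ} (h : WordEquiv u w) : star ∅ u = star ∅ w :=
  star_eq_of_weaklyDominated h.1.weaklyDominated h.2.weaklyDominated

/-! ### Survival of letters and monotonicity of the star action -/

theorem mem_starLetter (S : Finset ℕ) (m : ℕ) : m ∈ starLetter S m := by
  unfold starLetter; split_ifs <;> simp

theorem mem_starLetter_of_lt {S : Finset ℕ} {x m : ℕ} (hx : x ∈ S) (h : x < m) :
    x ∈ starLetter S m := by
  unfold starLetter
  split_ifs with h1
  · refine Finset.mem_insert_of_mem (Finset.mem_erase.2 ⟨?_, hx⟩)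
    have := (Finset.mem_filter.1 (Finset.min'_mem _ h1)).2
    omega
  · exact Finset.mem_insert_of_mem hx

theorem mem_star_of_forall_lt {S : Finset ℕ} {x : ℕ} (hx : x ∈ S) (w : List ℕ)
    (h : ∀ a ∈ w, x < a) : x ∈ star S w := by
  induction w generalizing S with
  | nil => exact hx
  | cons m w ih =>
    exact ih (mem_starLetter_of_lt hx (h m (by simp))) fun a ha => h a (by simp [ha])

/-- The letters of an increasing word survive. -/
theorem mem_star_of_mem {S : Finset ℕ} {w : List ℕ} (hw : w.Pairwise (· < ·)) {x : ℕ}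
    (hx : x ∈ w) : x ∈ star S w := by
  induction w generalizing S with
  | nil => simp at hx
  | cons m w ih =>
    rw [List.pairwise_cons] at hw
    rcases List.mem_cons.1 hx with rfl | hx
    · exact mem_star_of_forall_lt (mem_starLetter S x) w hw.1
    · exact ih hw.2 hx

/-- The only danger is that the element removed from `S'` lies in `S`. Being the smallest one `≥ m`
in the larger set, it is then also the one removed from `S`. -/
theorem starLetter_subset_starLetter {S S' : Finset ℕ} (h : S ⊆ S') (m : ℕ) :
    starLetter S m ⊆ starLetter S' m := by
  intro x hx
  by_cases hxm : x = m
  · exact hxm ▸ mem_starLetter S' x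
  unfold starLetter at hx ⊢
  have hsub : (S.filter fun x => m ≤ x) ⊆ S'.filter fun x => m ≤ x :=
    Finset.filter_subset_filter _ h
  split_ifs at hx with h1
  · have h2 := h1.mono hsub
    rw [dif_pos h2]
    simp only [Finset.mem_insert, hxm, Finset.mem_erase, false_or] at hx ⊢
    refine ⟨fun e => hx.1 ?_, h hx.2⟩
    have h3 := Finset.min'_mem _ h2
    rw [← e, Finset.mem_filter] at h3
    refine le_antisymm ?_ (Finset.min'_le _ _ (by simp [hx.2, h3.2]))
    rw [e]
    exact Finset.min'_subset h1 hsub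
  · simp only [Finset.mem_insert, hxm, false_or] at hx
    split_ifs with h2
    · simp only [Finset.mem_insert, hxm, Finset.mem_erase, false_or]
      refine ⟨fun e => h1 ⟨x, ?_⟩, h hx⟩
      have h3 := Finset.min'_mem _ h2
      rw [← e, Finset.mem_filter] at h3
      simp [hx, h3.2]
    · simp [h hx]

theorem star_subset_star {S S' : Finset ℕ} (h : S ⊆ S') (w : List ℕ) : star S w ⊆ star S' w := by
  induction w generalizing S S' with
  | nil => exact h
  | cons m w ih => exact ih (starLetter_subset_starLetter h m)

theorem card_star_le {w : List ℕ} {n : ℕ}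
    (h : ∀ l : List ℕ, l.Sublist w → l.Pairwise (· < ·) → l.length ≤ n) :
    (star ∅ w).card ≤ n := by
  obtain ⟨t, ht⟩ := exists_countBelow_eq_card (star ∅ w)
  obtain ⟨l, h1, h2, _, h4⟩ := exists_sublist_length_eq_countBelow_star w t
  rw [← ht, ← h4]
  exact h l h1 h2

theorem pos_of_mem_star {S : Finset ℕ} {w : List ℕ} (hS : ∀ x ∈ S, 0 < x) (hw : ∀ x ∈ w, 0 < x) :
    ∀ x ∈ star S w, 0 < x := by
  induction w generalizing S with
  | nil => exact hS
  | cons m w ih =>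
    refine ih (fun x hx => ?_) fun x hx => hw x (by simp [hx])
    have hm := hw m (by simp)
    unfold starLetter at hx
    split_ifs at hx
    · rcases Finset.mem_insert.1 hx with rfl | hx
      · exact hm
      · exact hS x (Finset.mem_of_mem_erase hx)
    · rcases Finset.mem_insert.1 hx with rfl | hx
      · exact hm
      · exact hS x hx

/-! ### Equivalences between words of two adjacent columns -/

theorem sublist_of_subset_of_pairwise {α : Type*} {r : α → α → Prop}
    (hr : ∀ a b, r a b → ¬ r b a) {l₂ : List α} : ∀ {l₁ : List α}, l₁.Pairwise r →
    l₂.Pairwise r → l₁ ⊆ l₂ → l₁.Sublist l₂ := by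
  induction l₂ with
  | nil => intro l₁ _ _ h; rw [List.subset_nil.1 h]
  | cons b t ih =>
    intro l₁ h₁ h₂ h
    rw [List.pairwise_cons] at h₂
    cases l₁ with
    | nil => exact List.nil_sublist _
    | cons a s =>
      rw [List.pairwise_cons] at h₁
      by_cases hab : a = b
      · subst hab
        refine (ih h₁.2 h₂.2 fun x hx => ?_).cons_cons a
        rcases List.mem_cons.1 (h (List.mem_cons_of_mem _ hx)) with rfl | h3
        · exact absurd (h₁.1 _ hx) (fun h4 => hr _ _ h4 h4)
        · exact h3
      · have hat : a ∈ t := (List.mem_cons.1 (h List.mem_cons_self)).resolve_left hab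
        refine (ih (List.pairwise_cons.2 h₁) h₂.2 fun x hx => ?_).cons b
        rcases List.mem_cons.1 (h hx) with rfl | h3
        · rcases List.mem_cons.1 hx with rfl | hx
          · exact absurd rfl hab
          · exact absurd (h₁.1 _ hx) (hr _ _ (h₂.1 _ hat))
        · exact h3

theorem pairwise_lt_sort (S : Finset ℕ) : S.sort.Pairwise (· < ·) := (S.sortedLT_sort).pairwise

theorem sort_eq_of_pairwise_lt {S : Finset ℕ} {l : List ℕ} (h : l.Pairwise (· < ·))
    (hm : ∀ x, x ∈ l ↔ x ∈ S) : l = S.sort :=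
  h.eq_of_mem_iff (pairwise_lt_sort S) fun x => by simp [hm]

theorem sort_sublist_sort {S S' : Finset ℕ} (h : S ⊆ S') : S.sort.Sublist S'.sort :=
  sublist_of_subset_of_pairwise (fun a b h => by omega) (pairwise_lt_sort S) (pairwise_lt_sort S')
    fun x hx => by simpa using h (by simpa using hx)

/-- Subsequences of an increasing word are subsets of its letters, so domination of two-column words
becomes a statement about pairs of subsets. -/
theorem dominated_sort_append {A B A' B' : Finset ℕ}
    (h : ∀ L₁ ⊆ A, ∀ L₂ ⊆ B, (∀ a ∈ L₁, ∀ b ∈ L₂, a < b) → ∃ L₁' ⊆ A', ∃ L₂' ⊆ B',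
      (∀ a ∈ L₁', ∀ b ∈ L₂', a < b) ∧ L₁'.card + L₂'.card = L₁.card + L₂.card ∧
      ∀ a ∈ L₁' ∪ L₂', (∃ b ∈ L₁ ∪ L₂, b ≤ a) ∧ ∃ b ∈ L₁ ∪ L₂, a ≤ b) :
    Dominated (A.sort ++ B.sort) (A'.sort ++ B'.sort) := by
  intro l h1 h2
  rw [List.sublist_append_iff] at h1
  obtain ⟨l1, l2, rfl, h3, h4⟩ := h1
  rw [List.pairwise_append] at h2
  have e1 : l1.toFinset.sort = l1 := (sort_eq_of_pairwise_lt h2.1 (by simp)).symm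
  have e2 : l2.toFinset.sort = l2 := (sort_eq_of_pairwise_lt h2.2.1 (by simp)).symm
  obtain ⟨L1, s1, L2, s2, h5, h6, h7⟩ := h l1.toFinset
    (fun x hx => by simpa using h3.subset (by simpa using hx)) l2.toFinset
    (fun x hx => by simpa using h4.subset (by simpa using hx))
    (fun a ha b hb => h2.2.2 a (by simpa using ha) b (by simpa using hb))
  refine ⟨L1.sort ++ L2.sort, (sort_sublist_sort s1).append (sort_sublist_sort s2), ?_, ?_, ?_⟩
  · rw [List.pairwise_append]
    exact ⟨pairwise_lt_sort _, pairwise_lt_sort _, fun a ha b hb =>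
      h5 a (by simpa using ha) b (by simpa using hb)⟩
  · have := congrArg List.length e1
    have := congrArg List.length e2
    simp only [List.length_append, Finset.length_sort] at *
    omega
  · intro a ha
    have := h7 a (by simpa using ha)
    simpa using this

/-- Letters of a column that have copies in the next column, suitably aligned, can be omitted. -/
theorem wordEquiv_of_copy_right {C K D : Finset ℕ} (hK : K ⊆ C) (ψ : ℕ → ℕ)
    (h : ∀ y ∈ C, y ∉ K → ψ y = y ∧ ∀ b ∈ C, y ≤ b → ψ b ∈ D ∧ ψ b ≤ b ∧
      ∀ b' ∈ C, b < b' → ψ b < ψ b') :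
    WordEquiv (C.sort ++ D.sort) (K.sort ++ D.sort) := by
  refine ⟨dominated_sort_append fun L₁ h1 L₂ h2 h12 => ?_,
    .of_sublist ((sort_sublist_sort hK).append (.refl _))⟩
  by_cases hne : (L₁ \ K).Nonempty
  -- With `y` the smallest letter to be omitted, the letters below `y` already lie in `K`; all the
  -- others are moved by `ψ` into the next column. They stay `≥ y` because `ψ` fixes `y` and is
  -- increasing from there on.
  · obtain ⟨y, hy, hymin⟩ := (L₁ \ K).exists_min_image id hne
    rw [Finset.mem_sdiff] at hy
    obtain ⟨hyy, hψ⟩ := h y (h1 hy.1) hy.2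
    have hle : ∀ b ∈ L₁, y ≤ b → y ≤ ψ b := fun b hb hyb => by
      rcases hyb.eq_or_lt with rfl | hlt
      · exact hyy.ge
      · have := (hψ y (h1 hy.1) le_rfl).2.2 b (h1 hb) hlt
        omega
    have hinj : Set.InjOn ψ (L₁.filter (y ≤ ·)) := by
      intro a ha b hb hab
      simp only [Finset.coe_filter, Set.mem_ofPred_eq] at ha hb
      rcases lt_trichotomy a b with hlt | heq | hlt
      · have := (hψ a (h1 ha.1) ha.2).2.2 b (h1 hb.1) hlt
        omega
      · exact heq
      · have := (hψ b (h1 hb.1) hb.2).2.2 a (h1 ha.1) hlt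
        omega
    refine ⟨L₁.filter (· < y), fun x hx => ?_, (L₁.filter (y ≤ ·)).image ψ ∪ L₂, ?_, ?_, ?_, ?_⟩
    · rw [Finset.mem_filter] at hx
      by_contra hxK
      have := hymin x (Finset.mem_sdiff.2 ⟨hx.1, hxK⟩)
      simp only [id] at this
      omega
    · intro x hx
      rcases Finset.mem_union.1 hx with hx | hx
      · obtain ⟨b, hb, rfl⟩ := Finset.mem_image.1 hx
        rw [Finset.mem_filter] at hb
        exact (hψ b (h1 hb.1) hb.2).1
      · exact h2 hx
    · intro a ha b hb
      rw [Finset.mem_filter] at ha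
      rcases Finset.mem_union.1 hb with hb | hb
      · obtain ⟨c, hc, rfl⟩ := Finset.mem_image.1 hb
        rw [Finset.mem_filter] at hc
        exact ha.2.trans_le (hle c hc.1 hc.2)
      · exact h12 a ha.1 b hb
    · rw [Finset.card_union_of_disjoint, Finset.card_image_of_injOn hinj]
      · have := Finset.card_filter_add_card_filter_not (s := L₁) (· < y)
        simp only [not_lt] at this
        omega
      -- No letter is counted twice: `ψ c ≤ c`, and `c` is smaller than every letter of `L₂`.
      · rw [Finset.disjoint_left]
        intro x hx hx2
        obtain ⟨c, hc, rfl⟩ := Finset.mem_image.1 hx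
        rw [Finset.mem_filter] at hc
        have := h12 c hc.1 _ hx2
        have := (hψ c (h1 hc.1) hc.2).2.1
        omega
    · intro a ha
      simp only [Finset.mem_union, Finset.mem_filter, Finset.mem_image] at ha
      rcases ha with ha | ⟨c, hc, rfl⟩ | ha
      · exact ⟨⟨a, by simp [ha.1], le_rfl⟩, a, by simp [ha.1], le_rfl⟩
      · exact ⟨⟨y, by simp [hy.1], hle c hc.1 hc.2⟩, c, by simp [hc.1],
          (hψ c (h1 hc.1) hc.2).2.1⟩
      · exact ⟨⟨a, by simp [ha], le_rfl⟩, a, by simp [ha], le_rfl⟩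
  · rw [Finset.not_nonempty_iff_eq_empty, Finset.sdiff_eq_empty_iff_subset] at hne
    exact ⟨L₁, hne, L₂, h2, h12, rfl, fun a ha => ⟨⟨a, ha, le_rfl⟩, a, ha, le_rfl⟩⟩

/-- Letters of a column that have copies in the previous column, suitably aligned, can be
omitted. -/
theorem wordEquiv_of_copy_left {B C K : Finset ℕ} (hK : K ⊆ C) (φ : ℕ → ℕ)
    (h : ∀ x ∈ C, x ∉ K → φ x = x ∧ ∀ c ∈ C, c ≤ x → φ c ∈ B ∧ c ≤ φ c ∧
      ∀ c' ∈ C, c' < c → φ c' < φ c) :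
    WordEquiv (B.sort ++ C.sort) (B.sort ++ K.sort) := by
  refine ⟨dominated_sort_append fun L₁ h1 L₂ h2 h12 => ?_,
    .of_sublist ((List.Sublist.refl _).append (sort_sublist_sort hK))⟩
  by_cases hne : (L₂ \ K).Nonempty
  -- Mirror image of the previous argument: the letters up to the largest omitted one are moved to
  -- the previous column.
  · obtain ⟨y, hy, hymax⟩ := (L₂ \ K).exists_max_image id hne
    rw [Finset.mem_sdiff] at hy
    obtain ⟨hyy, hφ⟩ := h y (h2 hy.1) hy.2
    have hle : ∀ c ∈ L₂, c ≤ y → φ c ≤ y := fun c hc hcy => by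
      rcases hcy.eq_or_lt with rfl | hlt
      · exact hyy.le
      · have := (hφ y (h2 hy.1) le_rfl).2.2 c (h2 hc) hlt
        omega
    have hinj : Set.InjOn φ (L₂.filter (· ≤ y)) := by
      intro a ha b hb hab
      simp only [Finset.coe_filter, Set.mem_ofPred_eq] at ha hb
      rcases lt_trichotomy a b with hlt | heq | hlt
      · have := (hφ b (h2 hb.1) hb.2).2.2 a (h2 ha.1) hlt
        omega
      · exact heq
      · have := (hφ a (h2 ha.1) ha.2).2.2 b (h2 hb.1) hlt
        omega
    refine ⟨L₁ ∪ (L₂.filter (· ≤ y)).image φ, ?_, L₂.filter (y < ·), fun x hx => ?_, ?_, ?_, ?_⟩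
    · intro x hx
      rcases Finset.mem_union.1 hx with hx | hx
      · exact h1 hx
      · obtain ⟨b, hb, rfl⟩ := Finset.mem_image.1 hx
        rw [Finset.mem_filter] at hb
        exact (hφ b (h2 hb.1) hb.2).1
    · rw [Finset.mem_filter] at hx
      by_contra hxK
      have := hymax x (Finset.mem_sdiff.2 ⟨hx.1, hxK⟩)
      simp only [id] at this
      omega
    · intro a ha b hb
      rw [Finset.mem_filter] at hb
      rcases Finset.mem_union.1 ha with ha | ha
      · exact h12 a ha b hb.1
      · obtain ⟨c, hc, rfl⟩ := Finset.mem_image.1 ha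
        rw [Finset.mem_filter] at hc
        exact (hle c hc.1 hc.2).trans_lt hb.2
    · rw [Finset.card_union_of_disjoint, Finset.card_image_of_injOn hinj]
      · have := Finset.card_filter_add_card_filter_not (s := L₂) (· ≤ y)
        simp only [not_le] at this
        omega
      · rw [Finset.disjoint_left]
        intro x hx2 hx
        obtain ⟨c, hc, rfl⟩ := Finset.mem_image.1 hx
        rw [Finset.mem_filter] at hc
        have := h12 _ hx2 c hc.1
        have := (hφ c (h2 hc.1) hc.2).2.1
        omega
    · intro a ha
      simp only [Finset.mem_union, Finset.mem_filter, Finset.mem_image] at ha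
      rcases ha with (ha | ⟨c, hc, rfl⟩) | ha
      · exact ⟨⟨a, by simp [ha], le_rfl⟩, a, by simp [ha], le_rfl⟩
      · exact ⟨⟨c, by simp [hc.1], (hφ c (h2 hc.1) hc.2).2.1⟩, y, by simp [hy.1],
          hle c hc.1 hc.2⟩
      · exact ⟨⟨a, by simp [ha.1], le_rfl⟩, a, by simp [ha.1], le_rfl⟩
  · rw [Finset.not_nonempty_iff_eq_empty, Finset.sdiff_eq_empty_iff_subset] at hne
    exact ⟨L₁, h1, L₂, hne, h12, rfl, fun a ha => ⟨⟨a, ha, le_rfl⟩, a, ha, le_rfl⟩⟩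

/-! ### Reading order of boxes -/

/-- The boxes of column `j`, from bottom to top. -/
def readColumn (T : Filling) (j : ℕ) : List (ℕ × ℕ) :=
  ((List.range (T.cells.sup Prod.fst + 1)).reverse.filter fun i => (i, j) ∈ T.cells).map
    fun i => (i, j)

/-- The boxes, columns from left to right, each from bottom to top. -/
def readList (T : Filling) : List (ℕ × ℕ) :=
  (List.range (T.cells.sup Prod.snd + 1)).flatMap T.readColumn

theorem columnWord_eq_map (T : Filling) (j : ℕ) : T.columnWord j = (T.readColumn j).map T.entry := by
  simp [columnWord, readColumn, Function.comp_def]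

theorem word_eq_map (T : Filling) : T.word = T.readList.map T.entry := by
  simp only [word, readList, List.map_flatMap]
  congr 1
  funext j
  exact columnWord_eq_map T j

theorem mem_readColumn (T : Filling) (j : ℕ) (b : ℕ × ℕ) :
    b ∈ T.readColumn j ↔ b ∈ T.cells ∧ b.2 = j := by
  simp only [readColumn, List.mem_map, List.mem_filter, List.mem_reverse, List.mem_range,
    decide_eq_true_eq]
  constructor
  · rintro ⟨i, ⟨_, h⟩, rfl⟩
    exact ⟨h, rfl⟩
  · rintro ⟨h, rfl⟩
    exact ⟨b.1, ⟨Nat.lt_succ_of_le (Finset.le_sup (f := Prod.fst) h), h⟩, rfl⟩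

theorem mem_readList (T : Filling) (b : ℕ × ℕ) : b ∈ T.readList ↔ b ∈ T.cells := by
  simp only [readList, List.mem_flatMap, List.mem_range, mem_readColumn]
  constructor
  · rintro ⟨j, _, h, _⟩; exact h
  · intro h
    exact ⟨b.2, Nat.lt_succ_of_le (Finset.le_sup (f := Prod.snd) h), h, rfl⟩

/-- The box `a` is read before the box `b`. -/
def ReadBefore (a b : ℕ × ℕ) : Prop := a.2 < b.2 ∨ a.2 = b.2 ∧ b.1 < a.1

theorem pairwise_readColumn (T : Filling) (j : ℕ) :
    (T.readColumn j).Pairwise fun a b => b.1 < a.1 := by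
  unfold readColumn
  rw [List.pairwise_map]
  refine List.Pairwise.filter _ ?_
  rw [List.pairwise_reverse]
  exact List.pairwise_lt_range

theorem pairwise_readList (T : Filling) : T.readList.Pairwise ReadBefore := by
  unfold readList
  rw [List.pairwise_flatMap]
  constructor
  · intro j _
    refine (pairwise_readColumn T j).imp_of_mem ?_
    intro a b ha hb hab
    rw [mem_readColumn] at ha hb
    exact Or.inr ⟨ha.2.trans hb.2.symm, hab⟩
  · refine List.pairwise_lt_range.imp ?_
    intro i j hij a ha b hb
    rw [mem_readColumn] at ha hb
    left; omega

theorem mem_column (T : Filling) (j x : ℕ) :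
    x ∈ T.column j ↔ ∃ i, (i, j) ∈ T.cells ∧ T.entry (i, j) = x := by
  simp only [column, columnCells, Finset.mem_image, Finset.mem_filter]
  constructor
  · rintro ⟨b, ⟨h, rfl⟩, rfl⟩; exact ⟨b.1, h, rfl⟩
  · rintro ⟨i, h, rfl⟩; exact ⟨(i, j), ⟨h, rfl⟩, rfl⟩

theorem mem_word (T : Filling) (x : ℕ) : x ∈ T.word ↔ ∃ b ∈ T.cells, T.entry b = x := by
  simp [word_eq_map, mem_readList]

theorem IsDecreasing.columnWord_eq_sort {T : Filling} (h : T.IsDecreasing) (j : ℕ) :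
    T.columnWord j = (T.column j).sort := by
  refine sort_eq_of_pairwise_lt ?_ fun x => ?_
  · rw [columnWord_eq_map, List.pairwise_map]
    refine (pairwise_readColumn T j).imp_of_mem ?_
    intro a b ha hb hab
    rw [mem_readColumn] at ha hb
    exact h.2.2 b hb.1 a ha.1 (hb.2.trans ha.2.symm) hab
  · rw [columnWord_eq_map, mem_column]
    simp only [List.mem_map, mem_readColumn]
    constructor
    · rintro ⟨b, ⟨h, rfl⟩, rfl⟩; exact ⟨b.1, h, rfl⟩
    · rintro ⟨i, h, rfl⟩; exact ⟨(i, j), ⟨h, rfl⟩, rfl⟩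

theorem column_eq_empty {T : Filling} {j : ℕ} (h : T.cells.sup Prod.snd < j) :
    T.column j = ∅ := by
  refine Finset.eq_empty_of_forall_notMem fun x hx => ?_
  rw [mem_column] at hx
  obtain ⟨i, hi, _⟩ := hx
  have := Finset.le_sup (f := Prod.snd) hi
  simp only at this
  omega

/-- The concatenation of the columns `0, ..., n - 1`, each in increasing order. -/
def columnsWord (c : ℕ → Finset ℕ) (n : ℕ) : List ℕ :=
  (List.range n).flatMap fun j => (c j).sort

theorem columnsWord_succ (c : ℕ → Finset ℕ) (n : ℕ) :
    columnsWord c (n + 1) = columnsWord c n ++ (c n).sort := by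
  simp [columnsWord, List.range_succ]

theorem columnsWord_congr {c c' : ℕ → Finset ℕ} {n : ℕ} (h : ∀ j < n, c j = c' j) :
    columnsWord c n = columnsWord c' n := by
  induction n with
  | zero => rfl
  | succ n ih =>
    rw [columnsWord_succ, columnsWord_succ, ih fun j hj => h j (by omega), h n (by omega)]

theorem columnsWord_split (c : ℕ → Finset ℕ) (m n : ℕ) :
    columnsWord c (m + n) = columnsWord c m ++ columnsWord (fun j => c (m + j)) n := by
  induction n with
  | zero => simp [columnsWord]
  | succ n ih => rw [← add_assoc, columnsWord_succ, ih, columnsWord_succ, List.append_assoc]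

theorem columnsWord_eq_of_le {c : ℕ → Finset ℕ} {m n : ℕ} (hmn : m ≤ n)
    (h : ∀ j, m ≤ j → c j = ∅) : columnsWord c n = columnsWord c m := by
  obtain ⟨k, rfl⟩ := Nat.exists_eq_add_of_le hmn
  induction k with
  | zero => rfl
  | succ k ih =>
    rw [← add_assoc, columnsWord_succ, ih (by omega), h _ (by omega)]
    simp

/-- Empty columns contribute nothing, so `n` is free; this allows two tableaux of different widths
to be compared with a common `n`. -/
theorem IsDecreasing.word_eq_columnsWord {T : Filling} (h : T.IsDecreasing) {n : ℕ}
    (hn : T.cells.sup Prod.snd < n) : T.word = columnsWord T.column n := by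
  rw [columnsWord_eq_of_le (m := T.cells.sup Prod.snd + 1) hn fun j hj =>
    column_eq_empty (by omega)]
  unfold word columnsWord
  congr 1
  funext j
  exact h.columnWord_eq_sort j

/-! ### Sliding a tableau into one rook strip -/

/-- The box `b` is directly below or directly to the right of `a`. -/
def Precedes (a b : ℕ × ℕ) : Prop := b = (a.1 + 1, a.2) ∨ b = (a.1, a.2 + 1)

theorem isIsolated_iff (D : Finset (ℕ × ℕ)) (b : ℕ × ℕ) :
    IsIsolated D b ↔ ∀ c ∈ D, ¬ Precedes b c ∧ ¬ Precedes c b := by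
  unfold IsIsolated Precedes
  constructor
  · rintro ⟨h1, h2, h3⟩ c hc
    refine ⟨?_, ?_⟩
    · rintro (rfl | rfl)
      · exact h1 hc
      · exact h2 hc
    · rintro (h | h)
      · exact (h3 c hc).1 h.symm
      · exact (h3 c hc).2 h.symm
  · intro h
    exact ⟨fun hc => (h _ hc).1 (Or.inl rfl), fun hc => (h _ hc).1 (Or.inr rfl), fun c hc =>
      ⟨fun e => (h c hc).2 (Or.inl e.symm), fun e => (h c hc).2 (Or.inr e.symm)⟩⟩

/-- Order of the boxes of a tableau and of the sliding strip, when the strips of entries below `v`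
have been passed: the strip comes right after the entries `≥ v`. -/
def slideRank (p : Filling × Finset (ℕ × ℕ)) (v : ℕ) (b : ℕ × ℕ) : ℕ :=
  if b ∈ p.2 then 2 * v + 1 else 2 * p.1.entry b + 2

/-- What is known about an intermediate state of the slide of `T` into `E`. -/
structure SlideState (T : Filling) (E : Finset (ℕ × ℕ)) (v : ℕ)
    (p : Filling × Finset (ℕ × ℕ)) : Prop where
  mem_or : ∀ b, b ∈ T.cells ∪ E ↔ b ∈ p.1.cells ∨ b ∈ p.2
  notMem : ∀ b ∈ p.1.cells, b ∉ p.2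
  -- The central invariant: tableau and moving strip together behave like one decreasing tableau.
  -- Entries have even ranks and the strip has an odd one, so the strip fits strictly between two
  -- entries.
  rank_lt : ∀ a ∈ T.cells ∪ E, ∀ b ∈ T.cells ∪ E, Precedes a b → slideRank p v b < slideRank p v a
  unmoved : ∀ b ∈ p.1.cells, v ≤ p.1.entry b → b ∈ T.cells ∧ T.entry b = p.1.entry b
  unmoved' : ∀ b ∈ T.cells, v ≤ T.entry b → b ∈ p.1.cells ∧ p.1.entry b = T.entry b
  source : ∀ b ∈ p.1.cells, (b ∈ T.cells ∧ p.1.entry b = T.entry b) ∨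
    ∃ a ∈ T.cells, Precedes a b ∧ p.1.entry b = T.entry a
  target : ∀ b ∈ T.cells, T.entry b < v → (b ∈ p.1.cells ∧ p.1.entry b = T.entry b) ∨
    ∃ a ∈ p.1.cells, Precedes b a ∧ p.1.entry a = T.entry b
  -- A weak inequality between a new entry and the old entry before it; applied to horizontal
  -- neighbours it aligns column `j + 1` of the slide with column `j` of `T`.
  bound : ∀ b ∈ p.1.cells, ∀ a ∈ T.cells ∪ E, Precedes a b →
    a ∈ T.cells ∧ p.1.entry b ≤ T.entry a

namespace SlideState

variable {T : Filling} {E : Finset (ℕ × ℕ)} {v : ℕ} {p : Filling × Finset (ℕ × ℕ)}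

theorem mem_strip {b : ℕ × ℕ} :
    b ∈ p.1.strip v ↔ b ∈ p.1.cells ∧ p.1.entry b = v := by simp [strip]

theorem rank_of_mem_cells (h : SlideState T E v p) {b : ℕ × ℕ} (hb : b ∈ p.1.cells) :
    slideRank p v b = 2 * p.1.entry b + 2 := if_neg (h.notMem b hb)

theorem rank_of_mem_dots {b : ℕ × ℕ} (hb : b ∈ p.2) : slideRank p v b = 2 * v + 1 := if_pos hb

theorem cells_subset (h : SlideState T E v p) {b : ℕ × ℕ} (hb : b ∈ p.1.cells) :
    b ∈ T.cells ∪ E := (h.mem_or b).2 (Or.inl hb)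

theorem dots_subset (h : SlideState T E v p) {b : ℕ × ℕ} (hb : b ∈ p.2) :
    b ∈ T.cells ∪ E := (h.mem_or b).2 (Or.inr hb)

/-- The strip of `v` has rank `2 * v + 2` and the moving strip has rank `2 * v + 1`. Ranks strictly
decrease between adjacent boxes, so only one kind of adjacency is possible. -/
theorem precedes_strip_dots (h : SlideState T E v p) {a b : ℕ × ℕ}
    (ha : a ∈ p.1.strip v ∪ p.2) (hb : b ∈ p.1.strip v ∪ p.2) (hab : Precedes a b) :
    a ∈ p.1.strip v ∧ b ∈ p.2 := by
  have key : ∀ c ∈ p.1.strip v ∪ p.2, c ∈ T.cells ∪ E ∧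
      (c ∈ p.1.strip v ∧ slideRank p v c = 2 * v + 2 ∨ c ∈ p.2 ∧ slideRank p v c = 2 * v + 1) := by
    intro c hc
    rcases Finset.mem_union.1 hc with hc | hc
    · have hc' := mem_strip.1 hc
      exact ⟨h.cells_subset hc'.1, Or.inl ⟨hc, by rw [h.rank_of_mem_cells hc'.1, hc'.2]⟩⟩
    · exact ⟨h.dots_subset hc, Or.inr ⟨hc, rank_of_mem_dots hc⟩⟩
  obtain ⟨ka, ka'⟩ := key a ha
  obtain ⟨kb, kb'⟩ := key b hb
  have := h.rank_lt a ka b kb hab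
  rcases ka' with ka' | ka' <;> rcases kb' with kb' | kb'
  · omega
  · exact ⟨ka'.1, kb'.1⟩
  · omega
  · omega

theorem not_isIsolated_of_mem_strip (h : SlideState T E v p) {b : ℕ × ℕ} (hb : b ∈ p.1.strip v) :
    ¬ IsIsolated (p.1.strip v ∪ p.2) b ↔ ∃ c ∈ p.2, Precedes b c := by
  rw [isIsolated_iff]
  push Not
  constructor
  · rintro ⟨c, hc, h1⟩
    by_cases h2 : Precedes b c
    · exact ⟨c, (h.precedes_strip_dots (by simp [hb]) hc h2).2, h2⟩
    · have := (h.precedes_strip_dots hc (by simp [hb]) (h1 h2)).2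
      exact absurd this (h.notMem b (mem_strip.1 hb).1)
  · rintro ⟨c, hc, h1⟩
    exact ⟨c, by simp [hc], fun h2 => absurd h1 h2⟩

theorem not_isIsolated_of_mem_dots (h : SlideState T E v p) {b : ℕ × ℕ} (hb : b ∈ p.2) :
    ¬ IsIsolated (p.1.strip v ∪ p.2) b ↔ ∃ c ∈ p.1.strip v, Precedes c b := by
  rw [isIsolated_iff]
  push Not
  constructor
  · rintro ⟨c, hc, h1⟩
    by_cases h2 : Precedes b c
    · have := (h.precedes_strip_dots (by simp [hb]) hc h2).1
      exact absurd hb (h.notMem b (mem_strip.1 this).1)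
    · exact ⟨c, (h.precedes_strip_dots hc (by simp [hb]) (h1 h2)).1, h1 h2⟩
  · rintro ⟨c, hc, h1⟩
    exact ⟨c, by simp only [Finset.mem_union, hc, true_or], fun _ => h1⟩

theorem mem_slideStep_dots (h : SlideState T E v p) (b : ℕ × ℕ) : b ∈ (slideStep p v).2 ↔
    (b ∈ p.1.strip v ∧ ∃ c ∈ p.2, Precedes b c) ∨
      (b ∈ p.2 ∧ ¬ ∃ c ∈ p.1.strip v, Precedes c b) := by
  simp only [slideStep, switch, Finset.mem_union, Finset.mem_filter]
  refine or_congr (and_congr_right fun hb => h.not_isIsolated_of_mem_strip hb)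
    (and_congr_right fun hb => ?_)
  rw [← h.not_isIsolated_of_mem_dots hb, not_not]

theorem mem_switch_snd (h : SlideState T E v p) (b : ℕ × ℕ) : b ∈ (switch (p.1.strip v) p.2).2 ↔
    (b ∈ p.2 ∧ ∃ c ∈ p.1.strip v, Precedes c b) ∨
      (b ∈ p.1.strip v ∧ ¬ ∃ c ∈ p.2, Precedes b c) := by
  simp only [switch, Finset.mem_union, Finset.mem_filter]
  refine or_congr (and_congr_right fun hb => h.not_isIsolated_of_mem_dots hb)
    (and_congr_right fun hb => ?_)
  rw [← h.not_isIsolated_of_mem_strip hb, not_not]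

theorem mem_slideStep_cells (h : SlideState T E v p) (b : ℕ × ℕ) :
    b ∈ (slideStep p v).1.cells ↔ (b ∈ p.1.cells ∧ b ∉ p.1.strip v) ∨
      (b ∈ p.2 ∧ ∃ c ∈ p.1.strip v, Precedes c b) ∨
      (b ∈ p.1.strip v ∧ ¬ ∃ c ∈ p.2, Precedes b c) := by
  rw [← h.mem_switch_snd]
  simp [slideStep]

theorem entry_of_mem_switch {b : ℕ × ℕ} (h : b ∈ (switch (p.1.strip v) p.2).2) :
    (slideStep p v).1.entry b = v := if_pos h

theorem entry_of_notMem (h : SlideState T E v p) {b : ℕ × ℕ} (hb : b ∈ p.1.cells)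
    (hb' : b ∉ p.1.strip v) : (slideStep p v).1.entry b = p.1.entry b := by
  refine if_neg ?_
  show b ∉ (switch (p.1.strip v) p.2).2
  rw [h.mem_switch_snd]
  rintro (h1 | h1)
  · exact h.notMem b hb h1.1
  · exact hb' h1.1

theorem cells_cases (h : SlideState T E v p) {b : ℕ × ℕ} (hb : b ∈ (slideStep p v).1.cells) :
    (b ∈ p.1.cells ∧ b ∉ p.1.strip v ∧ (slideStep p v).1.entry b = p.1.entry b ∧
      p.1.entry b ≠ v) ∨
    ((slideStep p v).1.entry b = v ∧ b ∈ p.2 ∧ ∃ c ∈ p.1.strip v, Precedes c b) ∨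
    ((slideStep p v).1.entry b = v ∧ b ∈ p.1.strip v) := by
  rw [h.mem_slideStep_cells] at hb
  rcases hb with hb | hb | hb
  · exact Or.inl ⟨hb.1, hb.2, h.entry_of_notMem hb.1 hb.2, fun e => hb.2 (mem_strip.2 ⟨hb.1, e⟩)⟩
  · exact Or.inr (Or.inl ⟨entry_of_mem_switch ((h.mem_switch_snd b).2 (Or.inl hb)), hb⟩)
  · exact Or.inr (Or.inr ⟨entry_of_mem_switch ((h.mem_switch_snd b).2 (Or.inr hb)), hb.1⟩)

theorem step_mem_or (h : SlideState T E v p) (b : ℕ × ℕ) :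
    b ∈ T.cells ∪ E ↔ b ∈ (slideStep p v).1.cells ∨ b ∈ (slideStep p v).2 := by
  rw [h.mem_or, h.mem_slideStep_cells, h.mem_slideStep_dots]
  have : b ∈ p.1.strip v → b ∈ p.1.cells := fun h => (mem_strip.1 h).1
  generalize (∃ c ∈ p.1.strip v, Precedes c b) = P
  generalize (∃ c ∈ p.2, Precedes b c) = Q
  tauto

theorem step_notMem (h : SlideState T E v p) (b : ℕ × ℕ) (hb : b ∈ (slideStep p v).1.cells) :
    b ∉ (slideStep p v).2 := by
  rw [h.mem_slideStep_cells] at hb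
  rw [h.mem_slideStep_dots]
  have h1 : b ∈ p.1.strip v → b ∈ p.1.cells := fun h => (mem_strip.1 h).1
  have h2 := h.notMem b
  generalize (∃ c ∈ p.1.strip v, Precedes c b) = P at *
  generalize (∃ c ∈ p.2, Precedes b c) = Q at *
  tauto

/-- The ranks `2 * v + 1, 2 * v + 2` become `2 * v + 2, 2 * v + 3`. Every other rank is unchanged,
even and different from `2 * v + 2`, so it lies outside both ranges, on the same side of each.
Comparisons with an unaffected box therefore persist. -/
theorem rank_cases (h : SlideState T E v p) {b : ℕ × ℕ} (hb : b ∈ T.cells ∪ E) :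
    (b ∈ p.1.cells ∧ b ∉ p.1.strip v ∧ slideRank p v b = 2 * p.1.entry b + 2 ∧ p.1.entry b ≠ v ∧
      slideRank (slideStep p v) (v + 1) b = slideRank p v b) ∨
    (b ∈ p.1.strip v ∪ p.2 ∧ 2 * v + 1 ≤ slideRank p v b ∧ slideRank p v b ≤ 2 * v + 2 ∧
      2 * v + 2 ≤ slideRank (slideStep p v) (v + 1) b ∧
      slideRank (slideStep p v) (v + 1) b ≤ 2 * v + 3) := by
  by_cases hs : b ∈ p.1.strip v ∪ p.2
  · right
    refine ⟨hs, ?_, ?_, ?_⟩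
    · rcases Finset.mem_union.1 hs with h1 | h1
      · rw [h.rank_of_mem_cells (mem_strip.1 h1).1, (mem_strip.1 h1).2]; omega
      · rw [rank_of_mem_dots h1]
    · rcases Finset.mem_union.1 hs with h1 | h1
      · rw [h.rank_of_mem_cells (mem_strip.1 h1).1, (mem_strip.1 h1).2]
      · rw [rank_of_mem_dots h1]; omega
    · by_cases h2 : b ∈ (slideStep p v).2
      · rw [slideRank, if_pos h2]; omega
      · have h3 := ((h.step_mem_or b).1 hb).resolve_right h2
        rw [slideRank, if_neg h2]
        rcases h.cells_cases h3 with h4 | h4 | h4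
        · rcases Finset.mem_union.1 hs with h1 | h1
          · exact absurd h1 h4.2.1
          · exact absurd h1 (h.notMem b h4.1)
        · rw [h4.1]; omega
        · rw [h4.1]; omega
  · left
    rw [Finset.mem_union, not_or] at hs
    have h1 := ((h.mem_or b).1 hb).resolve_right hs.2
    have h2 := h.rank_of_mem_cells h1
    refine ⟨h1, hs.1, h2, fun e => hs.1 (mem_strip.2 ⟨h1, e⟩), ?_⟩
    have h3 : b ∈ (slideStep p v).1.cells := (h.mem_slideStep_cells b).2 (Or.inl ⟨h1, hs.1⟩)
    rw [slideRank, if_neg (h.step_notMem b h3), h.entry_of_notMem h1 hs.1, h2]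

theorem step_rank_lt (h : SlideState T E v p) (a : ℕ × ℕ) (ha : a ∈ T.cells ∪ E)
    (b : ℕ × ℕ) (hb : b ∈ T.cells ∪ E) (hab : Precedes a b) :
    slideRank (slideStep p v) (v + 1) b < slideRank (slideStep p v) (v + 1) a := by
  have hlt := h.rank_lt a ha b hb hab
  rcases h.rank_cases ha with h1 | h1 <;> rcases h.rank_cases hb with h2 | h2
  · omega
  · omega
  · omega
  -- Two adjacent affected boxes exchange their types: `a` joins the moving strip, of new rank `2 *
  -- v + 3`, and `b` receives the entry `v`, of rank `2 * v + 2`.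
  · obtain ⟨h3, h4⟩ := h.precedes_strip_dots h1.1 h2.1 hab
    have h5 : a ∈ (slideStep p v).2 := (h.mem_slideStep_dots a).2 (Or.inl ⟨h3, b, h4, hab⟩)
    have h6 : b ∈ (switch (p.1.strip v) p.2).2 := (h.mem_switch_snd b).2 (Or.inl ⟨h4, a, h3, hab⟩)
    have h7 : b ∈ (slideStep p v).1.cells :=
      (h.mem_slideStep_cells b).2 (Or.inr (Or.inl ⟨h4, a, h3, hab⟩))
    rw [slideRank, slideRank, if_pos h5, if_neg (h.step_notMem b h7), entry_of_mem_switch h6]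
    omega

theorem step (h : SlideState T E v p) : SlideState T E (v + 1) (slideStep p v) where
  mem_or := h.step_mem_or
  notMem := h.step_notMem
  rank_lt := h.step_rank_lt
  unmoved b hb hv := by
    rcases h.cells_cases hb with h1 | h1 | h1
    · rw [h1.2.2.1] at hv ⊢
      exact h.unmoved b h1.1 (by omega)
    · omega
    · omega
  unmoved' b hb hv := by
    obtain ⟨h1, h2⟩ := h.unmoved' b hb (by omega)
    have h3 : b ∉ p.1.strip v := fun h3 => by have := (mem_strip.1 h3).2; omega
    exact ⟨(h.mem_slideStep_cells b).2 (Or.inl ⟨h1, h3⟩), (h.entry_of_notMem h1 h3).trans h2⟩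
  source b hb := by
    rcases h.cells_cases hb with h1 | h1 | h1
    · rw [h1.2.2.1]
      exact h.source b h1.1
    · obtain ⟨h2, h3, c, hc, hcb⟩ := h1
      have hc' := mem_strip.1 hc
      obtain ⟨h4, h5⟩ := h.unmoved c hc'.1 hc'.2.ge
      exact Or.inr ⟨c, h4, hcb, by rw [h2, h5, hc'.2]⟩
    · obtain ⟨h2, hc⟩ := h1
      have hc' := mem_strip.1 hc
      obtain ⟨h4, h5⟩ := h.unmoved b hc'.1 hc'.2.ge
      exact Or.inl ⟨h4, by rw [h2, h5, hc'.2]⟩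
  target b hb hv := by
    rcases Nat.lt_succ_iff_lt_or_eq.1 hv with hv | hv
    · have key : ∀ a ∈ p.1.cells, p.1.entry a < v →
          a ∈ (slideStep p v).1.cells ∧ (slideStep p v).1.entry a = p.1.entry a := by
        intro a ha hav
        have h3 : a ∉ p.1.strip v := fun h3 => by have := (mem_strip.1 h3).2; omega
        exact ⟨(h.mem_slideStep_cells a).2 (Or.inl ⟨ha, h3⟩), h.entry_of_notMem ha h3⟩
      rcases h.target b hb hv with ⟨h1, h2⟩ | ⟨a, ha, h1, h2⟩
      · obtain ⟨h3, h4⟩ := key b h1 (by omega)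
        exact Or.inl ⟨h3, h4.trans h2⟩
      · obtain ⟨h3, h4⟩ := key a ha (by omega)
        exact Or.inr ⟨a, h3, h1, h4.trans h2⟩
    · obtain ⟨h1, h2⟩ := h.unmoved' b hb hv.ge
      have h3 : b ∈ p.1.strip v := mem_strip.2 ⟨h1, h2.trans hv⟩
      by_cases h4 : ∃ c ∈ p.2, Precedes b c
      · obtain ⟨c, hc, hbc⟩ := h4
        exact Or.inr ⟨c, (h.mem_slideStep_cells c).2 (Or.inr (Or.inl ⟨hc, b, h3, hbc⟩)), hbc,
          (entry_of_mem_switch ((h.mem_switch_snd c).2 (Or.inl ⟨hc, b, h3, hbc⟩))).trans hv.symm⟩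
      · exact Or.inl ⟨(h.mem_slideStep_cells b).2 (Or.inr (Or.inr ⟨h3, h4⟩)),
          (entry_of_mem_switch ((h.mem_switch_snd b).2 (Or.inr ⟨h3, h4⟩))).trans hv.symm⟩
  bound b hb a ha hab := by
    have hlt := h.rank_lt a ha b ((h.step_mem_or b).2 (Or.inl hb)) hab
    -- A box that receives or keeps `v` had rank at least `2 * v + 1`. Its predecessor has larger
    -- rank, so it is not in the moving strip, has entry `≥ v`, and has not been touched yet.
    have key : 2 * v + 1 ≤ slideRank p v b → a ∈ T.cells ∧ v ≤ T.entry a := by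
      intro h1
      have h2 : a ∉ p.2 := fun h2 => by rw [rank_of_mem_dots h2] at hlt; omega
      have h3 := ((h.mem_or a).1 ha).resolve_right h2
      rw [h.rank_of_mem_cells h3] at hlt
      obtain ⟨h4, h5⟩ := h.unmoved a h3 (by omega)
      exact ⟨h4, by omega⟩
    rcases h.cells_cases hb with h1 | h1 | h1
    · rw [h1.2.2.1]
      exact h.bound b h1.1 a ha hab
    · rw [h1.1]
      exact key (by rw [rank_of_mem_dots h1.2.1])
    · rw [h1.1]
      have hc' := mem_strip.1 h1.2
      exact key (by rw [h.rank_of_mem_cells hc'.1, hc'.2]; omega)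

theorem iterate (h : SlideState T E 0 (T, E)) (n : ℕ) :
    SlideState T E n ((List.range n).foldl slideStep (T, E)) := by
  induction n with
  | zero => exact h
  | succ n ih =>
    rw [List.range_succ, List.foldl_append]
    exact ih.step

end SlideState

/-! ### Skew shapes -/

theorem isLowerSet_of_pred {S : Finset (ℕ × ℕ)} (h1 : ∀ i j, (i + 1, j) ∈ S → (i, j) ∈ S)
    (h2 : ∀ i j, (i, j + 1) ∈ S → (i, j) ∈ S) : IsLowerSet (S : Set (ℕ × ℕ)) := by
  have k1 : ∀ k i j, (i + k, j) ∈ S → (i, j) ∈ S := by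
    intro k
    induction k with
    | zero => exact fun i j h => h
    | succ k ih => exact fun i j h => ih i j (h1 _ _ h)
  have k2 : ∀ k i j, (i, j + k) ∈ S → (i, j) ∈ S := by
    intro k
    induction k with
    | zero => exact fun i j h => h
    | succ k ih => exact fun i j h => ih i j (h2 _ _ h)
  rintro ⟨i, j⟩ ⟨i', j'⟩ hle hb
  obtain ⟨hi, hj⟩ := Prod.mk_le_mk.1 hle
  obtain ⟨k, rfl⟩ := Nat.exists_eq_add_of_le hi
  obtain ⟨l, rfl⟩ := Nat.exists_eq_add_of_le hj
  exact k2 l _ _ (k1 k _ _ hb)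

theorem mem_of_le {μ : YoungDiagram} {i j i' j' : ℕ} (h : (i', j') ∈ μ.cells) (hi : i ≤ i')
    (hj : j ≤ j') : (i, j) ∈ μ.cells := μ.isLowerSet (Prod.mk_le_mk.2 ⟨hi, hj⟩) h

/-- On a skew shape it suffices to compare adjacent boxes. -/
theorem isDecreasing_of_adjacent {S : Filling} {ν μ : YoungDiagram} (hS : S.cells = μ.cells \ ν.cells)
    (hpos : ∀ b ∈ S.cells, 0 < S.entry b)
    (h : ∀ a ∈ S.cells, ∀ b ∈ S.cells, Precedes a b → S.entry b < S.entry a) : S.IsDecreasing := by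
  have between : ∀ {i j i' j' i'' j'' : ℕ}, (i, j) ∈ S.cells → (i'', j'') ∈ S.cells → i ≤ i' →
      j ≤ j' → i' ≤ i'' → j' ≤ j'' → (i', j') ∈ S.cells := by
    intro i j i' j' i'' j'' h1 h2 a1 a2 a3 a4
    rw [hS, Finset.mem_sdiff] at *
    exact ⟨mem_of_le h2.1 a3 a4, fun h3 => h1.2 (mem_of_le h3 a1 a2)⟩
  have row : ∀ k i j, (i, j) ∈ S.cells → (i, j + k + 1) ∈ S.cells →
      S.entry (i, j + k + 1) < S.entry (i, j) := by
    intro k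
    induction k with
    | zero => exact fun i j h1 h2 => h _ h1 _ h2 (Or.inr rfl)
    | succ k ih =>
      intro i j h1 h2
      have h3 : (i, j + k + 1) ∈ S.cells := between h1 h2 le_rfl (by omega) le_rfl (by omega)
      exact (h _ h3 _ h2 (Or.inr rfl)).trans (ih i j h1 h3)
  have col : ∀ k i j, (i, j) ∈ S.cells → (i + k + 1, j) ∈ S.cells →
      S.entry (i + k + 1, j) < S.entry (i, j) := by
    intro k
    induction k with
    | zero => exact fun i j h1 h2 => h _ h1 _ h2 (Or.inl rfl)
    | succ k ih =>
      intro i j h1 h2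
      have h3 : (i + k + 1, j) ∈ S.cells := between h1 h2 (by omega) le_rfl (by omega) le_rfl
      exact (h _ h3 _ h2 (Or.inl rfl)).trans (ih i j h1 h3)
  refine ⟨hpos, ?_, ?_⟩
  · rintro ⟨i, j⟩ ha ⟨i', j'⟩ hb rfl hlt
    obtain ⟨k, hk⟩ := Nat.exists_eq_add_of_lt hlt
    simp only at hk
    subst hk
    exact row k _ _ ha hb
  · rintro ⟨i, j⟩ ha ⟨i', j'⟩ hb rfl hlt
    obtain ⟨k, hk⟩ := Nat.exists_eq_add_of_lt hlt
    simp only at hk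
    subst hk
    exact col k _ _ ha hb

/-- The relation between a decreasing tableau `T` of shape `μ/ν` and its slide `T'`, of
shape `ρ/ν'`. -/
structure SlideRelation (T T' : Filling) (ν ρ ν' : YoungDiagram) : Prop where
  cells : T'.cells = ρ.cells \ ν'.cells
  le_inner : ν ≤ ν'
  le_outer : ν' ≤ ρ
  subset_outer : T.cells ⊆ ρ.cells
  notMem_inner : ∀ b ∈ T.cells, b ∉ ν.cells
  isDecreasing : T'.IsDecreasing
  bound : ∀ i j, (i, j + 1) ∈ T'.cells → (i, j) ∈ ν.cells ∨
    (i, j) ∈ T.cells ∧ T'.entry (i, j + 1) ≤ T.entry (i, j)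
  source : ∀ b ∈ T'.cells, (b ∈ T.cells ∧ T'.entry b = T.entry b) ∨
    ∃ a ∈ T.cells, Precedes a b ∧ T'.entry b = T.entry a
  target : ∀ b ∈ T.cells, (b ∈ T'.cells ∧ T'.entry b = T.entry b) ∨
    ∃ a ∈ T'.cells, Precedes b a ∧ T'.entry a = T.entry b
  notMem_right : ∀ i j, (i, j) ∉ ν.cells → (i, j + 1) ∉ ν'.cells

theorem precedes_lt {T : Filling} (hT : T.IsDecreasing) {a b : ℕ × ℕ} (ha : a ∈ T.cells)
    (hb : b ∈ T.cells) (h : Precedes a b) : T.entry b < T.entry a := by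
  rcases h with rfl | rfl
  · exact hT.2.2 a ha _ hb rfl (by simp)
  · exact hT.2.1 a ha _ hb rfl (by simp)

theorem slideRelation_slide {T : Filling} (hT : T.IsDecreasing) {ν μ ρ : YoungDiagram}
    (hνμ : ν ≤ μ) (hμρ : μ ≤ ρ) (hcells : T.cells = μ.cells \ ν.cells) {E : Finset (ℕ × ℕ)}
    (hE : E = ρ.cells \ μ.cells) (hE' : ∀ a ∈ E, ∀ b ∈ E, ¬ Precedes a b) :
    ∃ ν', SlideRelation T (T.slide E) ν ρ ν' := by
  have hμρ' : μ.cells ⊆ ρ.cells := hμρ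
  have hνμ' : ν.cells ⊆ μ.cells := hνμ
  have hΩ : ∀ b, b ∈ T.cells ∪ E ↔ b ∈ ρ.cells ∧ b ∉ ν.cells := by
    intro b
    rw [Finset.mem_union, hcells, hE, Finset.mem_sdiff, Finset.mem_sdiff]
    have h1 := @hμρ' b
    have h2 := @hνμ' b
    tauto
  have hdisj : ∀ b ∈ T.cells, b ∉ E := by
    intro b hb hb'
    rw [hcells, Finset.mem_sdiff] at hb
    rw [hE, Finset.mem_sdiff] at hb'
    exact hb'.2 hb.1
  have hpred : ∀ a b : ℕ × ℕ, Precedes a b → ∀ κ : YoungDiagram, b ∈ κ.cells → a ∈ κ.cells := by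
    rintro ⟨i, j⟩ b (rfl | rfl) κ h
    · exact mem_of_le h (by simp) le_rfl
    · exact mem_of_le h le_rfl (by simp)
  have hstep : ∀ a ∈ T.cells ∪ E, ∀ b ∈ T.cells, Precedes a b → a ∈ T.cells := by
    intro a ha b hb hab
    rw [hcells, Finset.mem_sdiff] at hb ⊢
    exact ⟨hpred a b hab μ hb.1, ((hΩ a).1 ha).2⟩
  -- At `v = 0` the strip `E` has rank 1, below all ranks of `T`. No box of `E` precedes a box of
  -- `T`, and no two boxes of `E` are adjacent.
  have h0 : SlideState T E 0 (T, E) := by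
    refine ⟨fun b => Finset.mem_union, hdisj, ?_, fun b hb _ => ⟨hb, rfl⟩, fun b hb _ => ⟨hb, rfl⟩,
      fun b hb => Or.inl ⟨hb, rfl⟩, fun b hb h => absurd h (Nat.not_lt_zero _), ?_⟩
    · intro a ha b hb hab
      unfold slideRank
      by_cases h1 : b ∈ E
      · have h2 : a ∉ E := fun h2 => hE' a h2 b h1 hab
        rw [if_pos h1, if_neg h2]
        omega
      · have h2 := (Finset.mem_union.1 hb).resolve_right h1
        have h3 := hstep a ha b h2 hab
        rw [if_neg h1, if_neg (hdisj a h3)]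
        have := precedes_lt hT h3 h2 hab
        simp only
        omega
    · intro b hb a ha hab
      have h3 := hstep a ha b hb hab
      exact ⟨h3, (precedes_lt hT h3 hb hab).le⟩
  have h := h0.iterate (T.maxEntry + 1)
  have hslide : T.slide E = ((List.range (T.maxEntry + 1)).foldl slideStep (T, E)).1 := rfl
  set p := (List.range (T.maxEntry + 1)).foldl slideStep (T, E) with hp
  have hmaxT : ∀ b ∈ T.cells, T.entry b ≤ T.maxEntry := fun b hb =>
    Finset.le_sup (f := T.entry) hb
  have hmax : ∀ b ∈ p.1.cells, p.1.entry b ≤ T.maxEntry := by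
    intro b hb
    by_contra hlt
    obtain ⟨h1, h2⟩ := h.unmoved b hb (by omega)
    have := hmaxT b h1
    omega
  have hrank : ∀ b ∈ T.cells ∪ E, slideRank p (T.maxEntry + 1) b ≤ 2 * (T.maxEntry + 1) + 1 := by
    intro b hb
    rcases (h.mem_or b).1 hb with h1 | h1
    · rw [h.rank_of_mem_cells h1]
      have := hmax b h1
      omega
    · rw [SlideState.rank_of_mem_dots h1]
  -- Once all entries are passed the moving strip has the maximal rank, so outside `ν` nothing
  -- precedes its boxes. Hence `ν` together with the strip is a Young diagram: the new inner shape
  -- `ν'`.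
  have hdots : ∀ a ∈ T.cells ∪ E, ∀ b ∈ p.2, ¬ Precedes a b := by
    intro a ha b hb hab
    have h1 := h.rank_lt a ha b (h.dots_subset hb) hab
    rw [SlideState.rank_of_mem_dots hb] at h1
    have := hrank a ha
    omega
  have hclosed : ∀ a b, Precedes a b → b ∈ ν.cells ∪ p.2 → a ∈ ν.cells ∪ p.2 := by
    intro a b hab hb
    rw [Finset.mem_union] at hb ⊢
    rcases hb with hb | hb
    · exact Or.inl (hpred a b hab ν hb)
    · left
      by_contra h1
      exact hdots a ((hΩ a).2 ⟨hpred a b hab ρ ((hΩ b).1 (h.dots_subset hb)).1, h1⟩) b hb hab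
  let ν' : YoungDiagram := ⟨ν.cells ∪ p.2, isLowerSet_of_pred
    (fun i j hb => hclosed (i, j) _ (Or.inl rfl) hb)
    (fun i j hb => hclosed (i, j) _ (Or.inr rfl) hb)⟩
  have hcells' : p.1.cells = ρ.cells \ ν'.cells := by
    ext b
    show b ∈ p.1.cells ↔ b ∈ ρ.cells \ (ν.cells ∪ p.2)
    have h1 := hΩ b
    have h2 := h.mem_or b
    have h3 := h.notMem b
    rw [Finset.mem_sdiff, Finset.mem_union]
    tauto
  rw [hslide]
  refine ⟨ν', hcells', ?_, ?_, ?_, ?_, ?_, ?_, h.source, ?_, ?_⟩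
  · exact fun b hb => (Finset.mem_union_left _ hb : b ∈ ν.cells ∪ p.2)
  · intro b hb
    have hb' : b ∈ ν.cells ∪ p.2 := hb
    rcases Finset.mem_union.1 hb' with h1 | h1
    · exact hμρ (hνμ h1)
    · exact ((hΩ b).1 (h.dots_subset h1)).1
  · exact fun b hb => ((hΩ b).1 (Finset.mem_union_left _ hb)).1
  · exact fun b hb => ((hΩ b).1 (Finset.mem_union_left _ hb)).2
  · refine isDecreasing_of_adjacent hcells' ?_ ?_
    · intro b hb
      rcases h.source b hb with ⟨h1, h2⟩ | ⟨a, h1, _, h2⟩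
      · rw [h2]; exact hT.1 b h1
      · rw [h2]; exact hT.1 a h1
    · intro a ha b hb hab
      have := h.rank_lt a (h.cells_subset ha) b (h.cells_subset hb) hab
      rw [h.rank_of_mem_cells ha, h.rank_of_mem_cells hb] at this
      omega
  · intro i j hb
    by_cases h1 : (i, j) ∈ ν.cells
    · exact Or.inl h1
    · right
      refine h.bound _ hb (i, j) ((hΩ _).2 ⟨?_, h1⟩) (Or.inr rfl)
      exact hpred (i, j) _ (Or.inr rfl) ρ ((hΩ _).1 (h.cells_subset hb)).1
  · exact fun b hb => h.target b hb (Nat.lt_succ_of_le (hmaxT b hb))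
  · intro i j h1 h2
    have h2' : (i, j + 1) ∈ ν.cells ∪ p.2 := h2
    rcases Finset.mem_union.1 h2' with h3 | h3
    · exact h1 (hpred (i, j) _ (Or.inr rfl) ν h3)
    · refine hdots (i, j) ((hΩ _).2 ⟨?_, h1⟩) _ h3 (Or.inr rfl)
      exact hpred (i, j) _ (Or.inr rfl) ρ ((hΩ _).1 (h.dots_subset h3)).1

/-! ### Invariance of the star set under a slide -/

theorem IsDecreasing.column_lt_iff {T : Filling} (hT : T.IsDecreasing) {i i' j : ℕ}
    (h : (i, j) ∈ T.cells) (h' : (i', j) ∈ T.cells) :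
    T.entry (i, j) < T.entry (i', j) ↔ i' < i := by
  constructor
  · intro hlt
    by_contra hle
    rcases (not_lt.1 hle).eq_or_lt with rfl | h2
    · omega
    · have := hT.2.2 _ h _ h' rfl h2
      omega
  · exact fun hlt => hT.2.2 _ h' _ h rfl hlt

namespace SlideRelation

variable {T T' : Filling} {ν ρ ν' : YoungDiagram}

/-- A letter of column `j` that `T'` lacks there can only have moved one box to the right. The
aligning map sends an entry of `T` to its right neighbour in `T'`, which is no larger by `bound`. -/
theorem wordEquiv_right (h : SlideRelation T T' ν ρ ν') (hT : T.IsDecreasing) (j : ℕ) :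
    WordEquiv ((T.column j).sort ++ (T'.column (j + 1)).sort)
      ((T.column j ∩ T'.column j).sort ++ (T'.column (j + 1)).sort) := by
  have hrow : ∀ v ∈ T.column j, ∃ i, (i, j) ∈ T.cells ∧ T.entry (i, j) = v :=
    fun v hv => (mem_column T j v).1 hv
  choose! row hrow hval using hrow
  refine wordEquiv_of_copy_right Finset.inter_subset_left (fun v => T'.entry (row v, j + 1)) ?_
  intro y hy hyK
  have hyT' : y ∉ T'.column j := fun h1 => hyK (Finset.mem_inter.2 ⟨hy, h1⟩)
  have hcopy : (row y, j + 1) ∈ T'.cells ∧ T'.entry (row y, j + 1) = y := by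
    rcases h.target _ (hrow y hy) with ⟨h1, h2⟩ | ⟨a, h1, rfl | rfl, h2⟩
    · exact absurd ((mem_column _ _ _).2 ⟨_, h1, h2.trans (hval y hy)⟩) hyT'
    · exact absurd ((mem_column _ _ _).2 ⟨_, h1, h2.trans (hval y hy)⟩) hyT'
    · exact ⟨h1, h2.trans (hval y hy)⟩
  -- Letters `≥ y` lie in rows weakly above that of `y`, so their right neighbours are in `ρ`;
  -- `notMem_right` keeps these boxes out of `ν'`.
  have hcell : ∀ b ∈ T.column j, y ≤ b → (row b, j + 1) ∈ T'.cells := by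
    intro b hb hyb
    have hle : row b ≤ row y := by
      by_contra hlt
      have := (hT.column_lt_iff (hrow b hb) (hrow y hy)).2 (not_le.1 hlt)
      rw [hval b hb, hval y hy] at this
      omega
    have h1 := hcopy.1
    rw [h.cells, Finset.mem_sdiff] at h1 ⊢
    exact ⟨mem_of_le h1.1 hle le_rfl, h.notMem_right _ _ (h.notMem_inner _ (hrow b hb))⟩
  refine ⟨hcopy.2, fun b hb hyb => ⟨(mem_column _ _ _).2 ⟨_, hcell b hb hyb, rfl⟩, ?_, ?_⟩⟩
  · rcases h.bound _ _ (hcell b hb hyb) with h1 | ⟨_, h1⟩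
    · exact absurd h1 (h.notMem_inner _ (hrow b hb))
    · exact h1.trans (hval b hb).le
  · intro b' hb' hlt
    rw [h.isDecreasing.column_lt_iff (hcell b hb hyb) (hcell b' hb' (hyb.trans hlt.le)),
      ← hT.column_lt_iff (hrow b hb) (hrow b' hb'), hval b hb, hval b' hb']
    exact hlt

/-- Dually, a letter of column `j + 1` of `T'` that `T` lacks there came from the box on its left.
The aligning map sends an entry of `T'` to its left neighbour in `T`. -/
theorem wordEquiv_left (h : SlideRelation T T' ν ρ ν') (hT : T.IsDecreasing) (j : ℕ) :
    WordEquiv ((T.column j).sort ++ (T'.column (j + 1)).sort)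
      ((T.column j).sort ++ (T.column (j + 1) ∩ T'.column (j + 1)).sort) := by
  have hrow : ∀ v ∈ T'.column (j + 1), ∃ i, (i, j + 1) ∈ T'.cells ∧ T'.entry (i, j + 1) = v :=
    fun v hv => (mem_column T' (j + 1) v).1 hv
  choose! row hrow hval using hrow
  refine wordEquiv_of_copy_left Finset.inter_subset_right (fun v => T.entry (row v, j)) ?_
  intro x hx hxK
  have hxT : x ∉ T.column (j + 1) := fun h1 => hxK (Finset.mem_inter.2 ⟨h1, hx⟩)
  have hcopy : (row x, j) ∈ T.cells ∧ T.entry (row x, j) = x := by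
    rcases h.source _ (hrow x hx) with ⟨h1, h2⟩ | ⟨⟨a1, a2⟩, h1, h3, h2⟩
    · exact absurd ((mem_column _ _ _).2 ⟨_, h1, h2.symm.trans (hval x hx)⟩) hxT
    · rw [hval x hx] at h2
      rcases h3 with h3 | h3
      · obtain ⟨-, rfl⟩ := Prod.mk.inj h3
        exact absurd ((mem_column _ _ _).2 ⟨_, h1, h2.symm⟩) hxT
      · obtain ⟨h4, h5⟩ := Prod.mk.inj h3
        obtain rfl : j = a2 := by simpa using h5
        simp only at h4
        rw [h4]
        exact ⟨h1, h2.symm⟩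
  have hcell : ∀ c ∈ T'.column (j + 1), c ≤ x →
      (row c, j) ∈ T.cells ∧ c ≤ T.entry (row c, j) := by
    intro c hc hcx
    have hle : row x ≤ row c := by
      by_contra hlt
      have := (h.isDecreasing.column_lt_iff (hrow x hx) (hrow c hc)).2 (not_le.1 hlt)
      rw [hval c hc, hval x hx] at this
      omega
    rcases h.bound _ _ (hrow c hc) with h1 | ⟨h1, h2⟩
    · exact absurd (mem_of_le h1 hle le_rfl) (h.notMem_inner _ hcopy.1)
    · exact ⟨h1, (hval c hc).symm.le.trans h2⟩
  refine ⟨hcopy.2, fun c hc hcx => ⟨(mem_column _ _ _).2 ⟨_, (hcell c hc hcx).1, rfl⟩,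
    (hcell c hc hcx).2, ?_⟩⟩
  intro c' hc' hlt
  rw [hT.column_lt_iff (hcell c' hc' (hlt.le.trans hcx)).1 (hcell c hc hcx).1,
    ← h.isDecreasing.column_lt_iff (hrow c' hc') (hrow c hc), hval c hc, hval c' hc']
  exact hlt

theorem column_zero_subset (h : SlideRelation T T' ν ρ ν') : T'.column 0 ⊆ T.column 0 := by
  intro x hx
  obtain ⟨i, hi, rfl⟩ := (mem_column _ _ _).1 hx
  rcases h.source _ hi with ⟨h1, h2⟩ | ⟨⟨a1, a2⟩, h1, h3 | h3, h2⟩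
  · exact (mem_column _ _ _).2 ⟨_, h1, h2.symm⟩
  · obtain ⟨-, rfl⟩ := Prod.mk.inj h3
    exact (mem_column _ _ _).2 ⟨_, h1, h2.symm⟩
  · have := (Prod.mk.inj h3).2
    simp at this

theorem wordEquiv_columnsWord (h : SlideRelation T T' ν ρ ν') (hT : T.IsDecreasing) (m : ℕ) :
    WordEquiv (columnsWord T.column m ++ (T'.column m).sort)
      (columnsWord T.column m ++ (T.column m ∩ T'.column m).sort) := by
  cases m with
  | zero =>
    rw [Finset.inter_eq_right.2 h.column_zero_subset]
    exact .refl _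
  | succ m =>
    rw [columnsWord_succ, List.append_assoc, List.append_assoc]
    exact (WordEquiv.refl _).append (h.wordEquiv_left hT m)

/-- A slide does not change `∅ ⋆ word(T)`. -/
theorem star_word_eq (h : SlideRelation T T' ν ρ ν') (hT : T.IsDecreasing) :
    star ∅ T.word = star ∅ T'.word := by
  obtain ⟨n, hn⟩ : ∃ n, n = max (T.cells.sup Prod.snd) (T'.cells.sup Prod.snd) + 1 := ⟨_, rfl⟩
  -- The hybrid sequence of columns: `m` columns of `T`, followed by columns of `T'`.
  let c : ℕ → ℕ → Finset ℕ := fun m j => if j < m then T.column j else T'.column j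
  have key : ∀ m k, m + 2 + k = n + 1 →
      WordEquiv (columnsWord (c (m + 1)) (n + 1)) (columnsWord (c m) (n + 1)) := by
    intro m k hmk
    have e1 : columnsWord (c m) (n + 1) = (columnsWord T.column m ++ (T'.column m).sort) ++
        ((T'.column (m + 1)).sort ++ columnsWord (fun j => T'.column (m + 2 + j)) k) := by
      rw [← hmk, columnsWord_split, columnsWord_succ, columnsWord_succ,
        columnsWord_congr (c' := T.column) fun j hj => if_pos hj]
      have e : (fun j => c m (m + 2 + j)) = fun j => T'.column (m + 2 + j) :=
        funext fun j => if_neg (by omega)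
      rw [e, show c m m = T'.column m from if_neg (by omega),
        show c m (m + 1) = T'.column (m + 1) from if_neg (by omega), List.append_assoc]
    have e2 : columnsWord (c (m + 1)) (n + 1) =
        columnsWord T.column m ++ (((T.column m).sort ++ (T'.column (m + 1)).sort) ++
          columnsWord (fun j => T'.column (m + 2 + j)) k) := by
      rw [← hmk, columnsWord_split, columnsWord_succ, columnsWord_succ,
        columnsWord_congr (c' := T.column) fun j hj => if_pos (by omega)]
      have e : (fun j => c (m + 1) (m + 2 + j)) = fun j => T'.column (m + 2 + j) :=
        funext fun j => if_neg (by omega)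
      rw [e, show c (m + 1) m = T.column m from if_pos (by omega),
        show c (m + 1) (m + 1) = T'.column (m + 1) from if_neg (by omega)]
      simp only [List.append_assoc]
    rw [e1, e2]
    -- The two hybrids differ only in column `m`. The version of `T` is reduced with the help of its
    -- right neighbour, that of `T'` with the help of its left neighbour, and both reduce to the
    -- intersection.
    have h1 := (WordEquiv.refl (columnsWord T.column m)).append
      ((h.wordEquiv_right hT m).append (.refl (columnsWord (fun j => T'.column (m + 2 + j)) k)))
    have h2 := (h.wordEquiv_columnsWord hT m).append (.refl ((T'.column (m + 1)).sort ++
      columnsWord (fun j => T'.column (m + 2 + j)) k))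
    refine h1.trans (.trans ?_ h2.symm)
    simp only [List.append_assoc]
    exact .refl _
  have all : ∀ m, m ≤ n → WordEquiv (columnsWord (c m) (n + 1)) (columnsWord (c 0) (n + 1)) := by
    intro m
    induction m with
    | zero => exact fun _ => .refl _
    | succ m ih =>
      intro hm
      exact (key m (n - m - 1) (by omega)).trans (ih (by omega))
  -- Column `n` is empty in both tableaux, so the `n` exchanges are enough although `n + 1` columns
  -- are read.
  have h1 : T.word = columnsWord (c n) (n + 1) := by
    rw [hT.word_eq_columnsWord (n := n) (by omega), columnsWord_succ,
      show c n n = T'.column n from if_neg (by omega), column_eq_empty (by omega)]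
    simp only [Finset.sort_empty, List.append_nil]
    exact columnsWord_congr fun j hj => (if_pos hj).symm
  have h2 : T'.word = columnsWord (c 0) (n + 1) := by
    rw [h.isDecreasing.word_eq_columnsWord (n := n + 1) (by omega)]
    exact columnsWord_congr fun j hj => (if_neg (by omega)).symm
  rw [h1, h2]
  exact (all n le_rfl).star_eq

end SlideRelation

/-! ### K-jeu-de-taquin and antinormal shapes -/

theorem kjdt_spec {T U : Filling} (hT : T.IsDecreasing) (hU : U.IsIncreasing)
    {ν μ ρ : YoungDiagram} (hνμ : ν ≤ μ) (hμρ : μ ≤ ρ) (hTc : T.cells = μ.cells \ ν.cells)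
    (hUc : U.cells = ρ.cells \ μ.cells) :
    ∃ ν' : YoungDiagram, ν' ≤ ρ ∧ (kjdt U T).cells = ρ.cells \ ν'.cells ∧
      (kjdt U T).IsDecreasing ∧ star ∅ (kjdt U T).word = star ∅ T.word := by
  have hpred : ∀ a b : ℕ × ℕ, Precedes a b → ∀ κ : YoungDiagram, b ∈ κ.cells → a ∈ κ.cells := by
    rintro ⟨i, j⟩ b (rfl | rfl) κ h
    · exact mem_of_le h (by simp) le_rfl
    · exact mem_of_le h le_rfl (by simp)
  have hlt : ∀ a ∈ U.cells, ∀ b ∈ U.cells, Precedes a b → U.entry a < U.entry b := by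
    rintro a ha b hb (rfl | rfl)
    · exact hU.2.2 a ha _ hb rfl (by simp)
    · exact hU.2.1 a ha _ hb rfl (by simp)
  have hclosed : ∀ n a b, Precedes a b → b ∈ μ.cells ∪ U.cells.filter (fun b => U.entry b < n) →
      a ∈ μ.cells ∪ U.cells.filter fun b => U.entry b < n := by
    intro n a b hab hb
    rw [Finset.mem_union, Finset.mem_filter] at hb ⊢
    rcases hb with hb | hb
    · exact Or.inl (hpred a b hab μ hb)
    · by_cases ha : a ∈ μ.cells
      · exact Or.inl ha
      · have hbρ := hb.1
        rw [hUc, Finset.mem_sdiff] at hbρ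
        have haU : a ∈ U.cells := by
          rw [hUc, Finset.mem_sdiff]; exact ⟨hpred a b hab ρ hbρ.1, ha⟩
        exact Or.inr ⟨haU, (hlt a haU b hb.1 hab).trans hb.2⟩
  -- The outer shape before the slide into the boxes of `U` with entry `n`; since `U` increases, it
  -- is a Young diagram.
  let κ : ℕ → YoungDiagram := fun n => ⟨μ.cells ∪ U.cells.filter fun b => U.entry b < n,
    isLowerSet_of_pred (fun i j hb => hclosed n (i, j) _ (Or.inl rfl) hb)
      (fun i j hb => hclosed n (i, j) _ (Or.inr rfl) hb)⟩
  have hκ : ∀ n b, b ∈ (κ n).cells ↔ b ∈ μ.cells ∨ b ∈ U.cells ∧ U.entry b < n := by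
    intro n b
    show b ∈ μ.cells ∪ _ ↔ _
    rw [Finset.mem_union, Finset.mem_filter]
  have hUμ : ∀ b ∈ U.cells, b ∉ μ.cells := fun b hb => by
    rw [hUc, Finset.mem_sdiff] at hb; exact hb.2
  have key : ∀ n, ∃ ν' : YoungDiagram, ν' ≤ κ n ∧
      ((List.range n).foldl (fun S a => S.slide (U.strip a)) T).cells = (κ n).cells \ ν'.cells ∧
      ((List.range n).foldl (fun S a => S.slide (U.strip a)) T).IsDecreasing ∧
      star ∅ ((List.range n).foldl (fun S a => S.slide (U.strip a)) T).word = star ∅ T.word := by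
    intro n
    induction n with
    | zero =>
      have h0 : (κ 0).cells = μ.cells := by ext b; simp [hκ]
      refine ⟨ν, ?_, ?_, hT, rfl⟩
      · exact fun b hb => by
          show b ∈ (κ 0).cells
          rw [h0]; exact hνμ hb
      · rw [h0]; exact hTc
    | succ n ih =>
      obtain ⟨ν', h1, h2, h3, h4⟩ := ih
      rw [List.range_succ, List.foldl_append]
      set S := (List.range n).foldl (fun S a => S.slide (U.strip a)) T
      have hle : κ n ≤ κ (n + 1) := fun b hb => by
        have hb' : b ∈ (κ n).cells := hb
        show b ∈ (κ (n + 1)).cells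
        rw [hκ] at hb' ⊢
        exact hb'.imp id fun h => ⟨h.1, by omega⟩
      have hE : U.strip n = (κ (n + 1)).cells \ (κ n).cells := by
        ext b
        rw [Finset.mem_sdiff, hκ, hκ, strip, Finset.mem_filter]
        have := hUμ b
        constructor
        · rintro ⟨h5, h6⟩
          exact ⟨Or.inr ⟨h5, by omega⟩, by rintro (h7 | h7); exacts [this h5 h7, by omega]⟩
        · rintro ⟨h5 | h5, h6⟩
          · exact absurd (Or.inl h5) h6
          · refine ⟨h5.1, ?_⟩
            by_contra h7
            exact h6 (Or.inr ⟨h5.1, by omega⟩)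
      obtain ⟨ν'', h5⟩ := slideRelation_slide h3 h1 hle h2 hE fun a ha b hb hab => by
        rw [strip, Finset.mem_filter] at ha hb
        have := hlt a ha.1 b hb.1 hab
        omega
      exact ⟨ν'', h5.le_outer, h5.cells, h5.isDecreasing, (h5.star_word_eq h3).symm.trans h4⟩
  obtain ⟨ν', h1, h2, h3, h4⟩ := key (U.maxEntry + 1)
  have hρ : (κ (U.maxEntry + 1)).cells = ρ.cells := by
    ext b
    rw [hκ]
    have h5 : b ∈ U.cells ↔ b ∈ ρ.cells ∧ b ∉ μ.cells := by rw [hUc, Finset.mem_sdiff]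
    constructor
    · rintro (h | h)
      · exact hμρ h
      · exact (h5.1 h.1).1
    · intro h
      by_cases h6 : b ∈ μ.cells
      · exact Or.inl h6
      · have h7 := h5.2 ⟨h, h6⟩
        exact Or.inr ⟨h7, Nat.lt_succ_of_le (Finset.le_sup (f := U.entry) h7)⟩
  refine ⟨ν', fun b hb => ?_, ?_, h3, h4⟩
  · show b ∈ ρ.cells
    rw [← hρ]; exact h1 hb
  · rw [← hρ]; exact h2

/-- An increasing subsequence of the reading word has at most one letter in each row. -/
theorem card_star_word_le {T : Filling} (hT : T.IsDecreasing) :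
    (star ∅ T.word).card ≤ (T.cells.image Prod.fst).card := by
  refine card_star_le fun l hl hs => ?_
  rw [word_eq_map] at hl
  obtain ⟨l', hl', rfl⟩ := List.sublist_map_iff.1 hl
  rw [List.pairwise_map] at hs
  rw [List.length_map]
  have hr := (pairwise_readList T).sublist hl'
  have hnd : (l'.map Prod.fst).Nodup := by
    rw [List.Nodup, List.pairwise_map]
    refine (hr.and hs).imp_of_mem ?_
    intro a b ha hb hab h1
    have ha' := (mem_readList T a).1 (hl'.subset ha)
    have hb' := (mem_readList T b).1 (hl'.subset hb)
    rcases hab.1 with h2 | h2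
    · have := hT.2.1 a ha' b hb' h1 h2
      omega
    · omega
  rw [← List.length_map (f := Prod.fst), ← List.toFinset_card_of_nodup hnd]
  refine Finset.card_le_card fun i hi => ?_
  simp only [List.mem_toFinset, List.mem_map] at hi
  obtain ⟨a, ha, rfl⟩ := hi
  exact Finset.mem_image_of_mem _ ((mem_readList T a).1 (hl'.subset ha))

/-- The columns of the boxes of an antinormal shape end at the column of its corner. -/
theorem IsAntinormal.exists_column {D : Finset (ℕ × ℕ)} (hD : IsAntinormal D) (hne : D.Nonempty) :
    ∃ c, ∀ i j, (i, j) ∈ D → j ≤ c ∧ (i, c) ∈ D := by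
  obtain ⟨⟨ν, μ, hνμ, hDc⟩, h⟩ := hD
  obtain ⟨z, hz, huniq⟩ := h.resolve_left hne.ne_empty
  have hmem : ∀ b, b ∈ D ↔ b ∈ μ.cells ∧ b ∉ ν.cells := fun b => by rw [hDc, Finset.mem_sdiff]
  refine ⟨z.2, ?_⟩
  -- Induction over the rows from the bottom upwards. If the last box of a row has a box below it
  -- but ends before column `z.2`, the row below forces another box on its right; with no box below,
  -- it is the corner.
  have key : ∀ n i, D.sup Prod.fst < i + n → ∀ j, (i, j) ∈ D → j ≤ z.2 ∧ (i, z.2) ∈ D := by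
    intro n
    induction n with
    | zero =>
      intro i hi j hj
      have := Finset.le_sup (f := Prod.fst) hj
      simp only at this
      omega
    | succ n ih =>
      intro i hi j hj
      obtain ⟨e, he, hemax⟩ := (D.filter (fun b => b.1 = i)).exists_max_image Prod.snd
        ⟨(i, j), by simp [hj]⟩
      rw [Finset.mem_filter] at he
      obtain ⟨e1, e2⟩ := e
      obtain ⟨he, rfl⟩ := he
      simp only at hemax he hi
      have hje : j ≤ e2 := hemax (e1, j) (by simp [hj])
      have hright : (e1, e2 + 1) ∉ D := fun h1 => by
        have := hemax (e1, e2 + 1) (by simp [h1])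
        simp only at this
        omega
      suffices h1 : e2 = z.2 by rw [← h1]; exact ⟨hje, he⟩
      by_cases hdown : (e1 + 1, e2) ∈ D
      · obtain ⟨h1, h2⟩ := ih (e1 + 1) (by omega) e2 hdown
        by_contra h3
        refine hright ((hmem _).2 ⟨mem_of_le ((hmem _).1 h2).1 (by omega) (by omega), fun h4 => ?_⟩)
        exact ((hmem _).1 he).2 (mem_of_le h4 le_rfl (by omega))
      · rw [← huniq (e1, e2) ⟨he, hdown, hright⟩]
  exact fun i j hij => key (D.sup Prod.fst + 1) i (by omega) j hij

/-- The rightmost column is an increasing suffix of the word, so it is contained in the star set. It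
has a box in every nonempty row, and the star set has at most one element per nonempty row. -/
theorem rightmostColumn_eq_star {T : Filling} (hT : T.IsDecreasing) (h : IsAntinormal T.cells) :
    T.rightmostColumn = star ∅ T.word := by
  by_cases hne : T.cells.Nonempty
  · obtain ⟨c, hcol⟩ := h.exists_column hne
    have hsup : T.cells.sup Prod.snd = c := by
      apply le_antisymm
      · exact Finset.sup_le fun b hb => (hcol b.1 b.2 hb).1
      · obtain ⟨b, hb⟩ := hne
        exact Finset.le_sup (f := Prod.snd) (hcol b.1 b.2 hb).2
    rw [rightmostColumn, hsup]
    refine Finset.eq_of_subset_of_card_le ?_ ?_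
    · intro x hx
      rw [hT.word_eq_columnsWord (n := c + 1) (by omega), columnsWord_succ, star_append]
      exact mem_star_of_mem (pairwise_lt_sort _) (by simpa using hx)
    · refine (card_star_word_le hT).trans ?_
      refine Finset.card_le_card_of_injOn (fun i => T.entry (i, c)) ?_ ?_
      · intro i hi
        obtain ⟨b, hb, rfl⟩ := Finset.mem_image.1 hi
        exact (mem_column _ _ _).2 ⟨b.1, (hcol b.1 b.2 hb).2, rfl⟩
      · intro i hi i' hi' hii
        obtain ⟨b, hb, rfl⟩ := Finset.mem_image.1 hi
        obtain ⟨b', hb', rfl⟩ := Finset.mem_image.1 hi'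
        have h1 := hT.column_lt_iff (hcol b.1 b.2 hb).2 (hcol b'.1 b'.2 hb').2
        have h2 := hT.column_lt_iff (hcol b'.1 b'.2 hb').2 (hcol b.1 b.2 hb).2
        simp only at hii
        omega
  · rw [Finset.not_nonempty_iff_eq_empty] at hne
    rw [hT.word_eq_columnsWord (n := 1) (by simp [hne])]
    have : ∀ j, T.column j = ∅ := fun j => by simp [column, columnCells, hne]
    rw [rightmostColumn, this]
    simp [columnsWord, this, star]

theorem rightmostColumn_of_isAntirectification {T T' : Filling} (hT : T.IsDecreasing)
    (h : T.IsAntirectification T') : T'.rightmostColumn = star ∅ T.word := by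
  obtain ⟨hanti, U, hU, ⟨ν, μ, ρ, h1, h2, h3, h4⟩, rfl⟩ := h
  obtain ⟨ν', -, -, h5, h6⟩ := kjdt_spec hT hU h1 h2 h3 h4
  rw [rightmostColumn_eq_star h5 hanti, h6]

/-- The slides keep the rectangle as outer shape, and a rectangle minus a Young diagram is empty or
has the corner of the rectangle as its only southeast corner. -/
theorem isAntirectification_kjdt {T U : Filling} (hshape : T.HasPartitionShape)
    (hT : T.IsDecreasing) (hU : U.IsIncreasing)
    (hUc : U.cells = boundingRectangle T.cells \ T.cells) : T.IsAntirectification (kjdt U T) := by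
  obtain ⟨μ, hμ⟩ := hshape
  have hrect : ∀ i j, (i, j) ∈ boundingRectangle T.cells ↔
      i < (T.cells.sup fun b => b.1 + 1) ∧ j < T.cells.sup fun b => b.2 + 1 := by
    simp [boundingRectangle]
  let ρ : YoungDiagram := ⟨boundingRectangle T.cells, by
    rintro ⟨i, j⟩ ⟨i', j'⟩ hle hb
    obtain ⟨h1, h2⟩ := Prod.mk_le_mk.1 hle
    rw [Finset.mem_coe, hrect] at *
    exact ⟨by omega, by omega⟩⟩
  have hTρ : T.cells ⊆ ρ.cells := by
    intro b hb
    show (b.1, b.2) ∈ boundingRectangle T.cells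
    rw [hrect]
    exact ⟨Nat.lt_of_succ_le (Finset.le_sup (f := fun b : ℕ × ℕ => b.1 + 1) hb),
      Nat.lt_of_succ_le (Finset.le_sup (f := fun b : ℕ × ℕ => b.2 + 1) hb)⟩
  have hle : μ ≤ ρ := fun b hb => hTρ (hμ ▸ hb)
  have hTc : T.cells = μ.cells \ (⊥ : YoungDiagram).cells := by rw [hμ]; simp
  have hUc' : U.cells = ρ.cells \ μ.cells := by rw [hUc, ← hμ]
  obtain ⟨ν', h1, h2, -, -⟩ := kjdt_spec hT hU bot_le hle hTc hUc'
  refine ⟨⟨⟨ν', ρ, h1, h2⟩, ?_⟩, U, hU, ⟨⊥, μ, ρ, bot_le, hle, hTc, hUc'⟩, rfl⟩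
  rw [h2]
  by_cases hne : (ρ.cells \ ν'.cells).Nonempty
  · right
    set R := T.cells.sup fun b => b.1 + 1
    set C := T.cells.sup fun b => b.2 + 1
    have hmem : ∀ i j, (i, j) ∈ ρ.cells \ ν'.cells ↔ (i < R ∧ j < C) ∧ (i, j) ∉ ν'.cells := by
      intro i j
      rw [Finset.mem_sdiff]
      exact and_congr_left fun _ => hrect i j
    obtain ⟨⟨i, j⟩, hb⟩ := hne
    rw [hmem] at hb
    refine ⟨(R - 1, C - 1), ⟨?_, ?_, ?_⟩, ?_⟩
    · rw [hmem]
      exact ⟨by omega, fun h3 => hb.2 (mem_of_le h3 (by omega) (by omega))⟩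
    · rw [hmem]; omega
    · rw [hmem]; omega
    · rintro ⟨i', j'⟩ ⟨h3, h4, h5⟩
      simp only at h4 h5
      rw [hmem] at h3 h4 h5
      have h6 : i' + 1 = R := by
        by_contra h7
        exact h4 ⟨⟨by omega, h3.1.2⟩, fun h8 => h3.2 (mem_of_le h8 (by omega) le_rfl)⟩
      have h7 : j' + 1 = C := by
        by_contra h7
        exact h5 ⟨⟨h3.1.1, by omega⟩, fun h8 => h3.2 (mem_of_le h8 le_rfl (by omega))⟩
      rw [Prod.mk.injEq]
      omega
  · exact Or.inl (Finset.not_nonempty_iff_eq_empty.1 hne)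

/-! ### The right key -/

theorem mem_dropColumns (T : Filling) (j i k : ℕ) :
    (i, k) ∈ (T.dropColumns j).cells ↔ (i, k + j) ∈ T.cells := by
  simp only [dropColumns, Finset.mem_image, Finset.mem_filter]
  constructor
  · rintro ⟨⟨a, b⟩, ⟨h1, h2⟩, h3⟩
    obtain ⟨rfl, rfl⟩ := Prod.mk.inj h3
    simp only at h2
    rwa [Nat.sub_add_cancel h2]
  · exact fun h => ⟨(i, k + j), ⟨h, by simp⟩, by simp⟩

theorem IsDecreasing.dropColumns {T : Filling} (hT : T.IsDecreasing) (j : ℕ) :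
    (T.dropColumns j).IsDecreasing := by
  refine ⟨?_, ?_, ?_⟩
  · rintro ⟨i, k⟩ h
    exact hT.1 _ ((mem_dropColumns T j i k).1 h)
  · rintro ⟨i, k⟩ h ⟨i', k'⟩ h' rfl hlt
    exact hT.2.1 _ ((mem_dropColumns T j _ _).1 h) _ ((mem_dropColumns T j _ _).1 h') rfl
      (by simpa using hlt)
  · rintro ⟨i, k⟩ h ⟨i', k'⟩ h' rfl hlt
    exact hT.2.2 _ ((mem_dropColumns T j _ _).1 h) _ ((mem_dropColumns T j _ _).1 h') rfl hlt

theorem HasPartitionShape.dropColumns {T : Filling} (hT : T.HasPartitionShape) (j : ℕ) :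
    (T.dropColumns j).HasPartitionShape := by
  obtain ⟨μ, hμ⟩ := hT
  refine ⟨⟨(T.dropColumns j).cells, isLowerSet_of_pred ?_ ?_⟩, rfl⟩
  · intro i k h
    rw [mem_dropColumns, hμ] at *
    exact mem_of_le h (by omega) le_rfl
  · intro i k h
    rw [mem_dropColumns, hμ] at *
    exact mem_of_le h le_rfl (by omega)

theorem column_dropColumns (T : Filling) (j k : ℕ) :
    (T.dropColumns j).column k = T.column (j + k) := by
  ext x
  simp only [mem_column, mem_dropColumns]
  rw [add_comm j k]
  rfl

theorem sup_snd_dropColumns_le (T : Filling) (j : ℕ) :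
    (T.dropColumns j).cells.sup Prod.snd ≤ T.cells.sup Prod.snd := by
  refine Finset.sup_le ?_
  rintro ⟨i, k⟩ h
  have := Finset.le_sup (f := Prod.snd) ((mem_dropColumns T j i k).1 h)
  simp only at this ⊢
  omega

theorem word_dropColumns {T : Filling} (hT : T.IsDecreasing) (j : ℕ) :
    (T.dropColumns j).word = (T.column j).sort ++ (T.dropColumns (j + 1)).word := by
  have h1 := sup_snd_dropColumns_le T j
  have h2 := sup_snd_dropColumns_le T (j + 1)
  rw [(hT.dropColumns j).word_eq_columnsWord (n := 1 + (T.cells.sup Prod.snd + 1)) (by omega),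
    (hT.dropColumns (j + 1)).word_eq_columnsWord (n := T.cells.sup Prod.snd + 1) (by omega),
    columnsWord_split]
  congr 1
  · simp [columnsWord, column_dropColumns]
  · refine columnsWord_congr fun k _ => ?_
    rw [column_dropColumns, column_dropColumns, add_assoc]

/-- Column `j` of the right key, as a set. -/
def rightKeyColumn (T : Filling) (j : ℕ) : Finset ℕ := star ∅ (T.dropColumns j).word

/-- Reading column `j` first means that the rest of the word acts on a larger initial set than `∅`.
-/
theorem rightKeyColumn_succ_subset {T : Filling} (hT : T.IsDecreasing) (j : ℕ) :
    T.rightKeyColumn (j + 1) ⊆ T.rightKeyColumn j := by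
  rw [rightKeyColumn, rightKeyColumn, word_dropColumns hT j, star_append]
  exact star_subset_star (Finset.empty_subset _) _

theorem rightKeyColumn_eq_empty {T : Filling} {j : ℕ}
    (h : T.cells.sup Prod.snd < j) : T.rightKeyColumn j = ∅ := by
  have : (T.dropColumns j).word = [] := by
    rw [List.eq_nil_iff_forall_not_mem]
    intro x hx
    obtain ⟨⟨i, k⟩, hb, -⟩ := (mem_word _ x).1 hx
    have := Finset.le_sup (f := Prod.snd) ((mem_dropColumns T j i k).1 hb)
    simp only at this
    omega
  rw [rightKeyColumn, this]
  rfl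

theorem mem_rightKey (T : Filling) (i j : ℕ) :
    (i, j) ∈ T.rightKey.cells ↔ i < (T.rightKeyColumn j).card := by
  simp only [rightKey, Finset.mem_biUnion, Finset.mem_range, Finset.mem_image, Prod.mk.injEq]
  constructor
  · rintro ⟨j', _, i', h, rfl, rfl⟩
    exact h
  · intro h
    refine ⟨j, ?_, i, h, rfl, rfl⟩
    by_contra h1
    rw [rightKeyColumn_eq_empty (by omega)] at h
    simp at h

theorem column_rightKey (T : Filling) (j : ℕ) :
    T.rightKey.column j = T.rightKeyColumn j := by
  ext x
  simp only [mem_column, mem_rightKey T]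
  rw [← Finset.mem_sort (· ≥ ·), List.mem_iff_getElem]
  constructor
  · rintro ⟨i, h, rfl⟩
    have h' : i < ((T.rightKeyColumn j).sort (· ≥ ·)).length := by rwa [Finset.length_sort]
    exact ⟨i, h', (List.getD_eq_getElem _ _ h').symm⟩
  · rintro ⟨i, h, rfl⟩
    refine ⟨i, by rwa [Finset.length_sort] at h, ?_⟩
    exact List.getD_eq_getElem _ _ h

theorem getD_le_getD_cons {a : ℕ} {l : List ℕ} (h : (a :: l).Pairwise (· ≥ ·)) (i : ℕ) :
    l.getD i 0 ≤ (a :: l).getD i 0 := by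
  induction l generalizing a i with
  | nil => simp
  | cons b l ih =>
    rw [List.pairwise_cons] at h
    cases i with
    | zero => simpa using h.1 b (by simp)
    | succ i =>
      rw [List.getD_cons_succ, List.getD_cons_succ]
      exact ih h.2 i

/-- Omitting letters of a weakly decreasing list only shifts smaller ones forward; past the end the
default `0` is harmless. This turns nested columns into weakly decreasing rows. -/
theorem getD_le_getD_of_sublist {l l' : List ℕ} (h : l.Sublist l') (h' : l'.Pairwise (· ≥ ·)) :
    ∀ i, l.getD i 0 ≤ l'.getD i 0 := by
  induction h with
  | slnil => simp
  | @cons l l' a _ ih =>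
    exact fun i => (ih (List.pairwise_cons.1 h').2 i).trans (getD_le_getD_cons h' i)
  | @cons_cons l l' a _ ih =>
    intro i
    cases i with
    | zero => simp
    | succ i =>
      rw [List.getD_cons_succ, List.getD_cons_succ]
      exact ih (List.pairwise_cons.1 h').2 i

theorem pairwise_gt_sort (S : Finset ℕ) : (S.sort (· ≥ ·)).Pairwise (· > ·) :=
  S.sortedGT_sort.pairwise

theorem isKey_rightKey {T : Filling} (hT : T.IsDecreasing) : T.rightKey.IsKey := by
  have hanti : Antitone T.rightKeyColumn := antitone_nat_of_succ_le (rightKeyColumn_succ_subset hT)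
  have hmem := mem_rightKey T
  have hget : ∀ i j, T.rightKey.entry (i, j) = ((T.rightKeyColumn j).sort (· ≥ ·)).getD i 0 :=
    fun i j => rfl
  refine ⟨⟨⟨T.rightKey.cells, isLowerSet_of_pred ?_ ?_⟩, rfl⟩, ⟨?_, ?_, ?_⟩, ?_⟩
  · intro i j h
    rw [hmem] at *
    omega
  · intro i j h
    rw [hmem] at *
    exact h.trans_le (Finset.card_le_card (hanti (Nat.le_succ j)))
  · rintro ⟨i, j⟩ h
    have h1 : T.rightKey.entry (i, j) ∈ T.rightKeyColumn j := by
      rw [← column_rightKey T]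
      exact (mem_column _ _ _).2 ⟨i, h, rfl⟩
    refine pos_of_mem_star (by simp) (fun x hx => ?_) _ h1
    obtain ⟨b, hb, rfl⟩ := (mem_word _ x).1 hx
    exact (hT.dropColumns j).1 b hb
  · rintro ⟨i, j⟩ - ⟨i', j'⟩ - rfl hlt
    rw [hget, hget]
    refine getD_le_getD_of_sublist ?_ ((pairwise_gt_sort _).imp le_of_lt) i
    exact sublist_of_subset_of_pairwise (fun a b h h' => lt_asymm h h') (pairwise_gt_sort _)
      (pairwise_gt_sort _) fun x hx => by simpa using hanti hlt.le (by simpa using hx)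
  · rintro ⟨i, j⟩ - ⟨i', j'⟩ hb rfl hlt
    rw [hmem, ← Finset.length_sort (· ≥ ·)] at hb
    have hlt' : i < i' := hlt
    rw [hget, hget, List.getD_eq_getElem _ _ hb, List.getD_eq_getElem _ _ (hlt'.trans hb)]
    exact List.pairwise_iff_getElem.1 (pairwise_gt_sort _) i i' _ hb hlt'
  · intro j
    rw [column_rightKey T, column_rightKey T]
    exact rightKeyColumn_succ_subset hT j

/-! ### Row reading word -/

/-- The boxes of row `k`, from left to right. -/
def rowBoxes (T : Filling) (k : ℕ) : List (ℕ × ℕ) :=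
  ((List.range (T.cells.sup Prod.snd + 1)).filter fun j => (k, j) ∈ T.cells).map fun j => (k, j)

/-- The boxes of the rows `m - 1, ..., 0`, in this order, each from left to right. -/
def rowsList (T : Filling) : ℕ → List (ℕ × ℕ)
  | 0 => []
  | k + 1 => T.rowBoxes k ++ T.rowsList k

/-- The columns `m - 1, ..., 0` of a tableau, in this order, each from top to bottom. -/
def reverseColumnsWord (P : Filling) : ℕ → List ℕ
  | 0 => []
  | k + 1 => (P.column k).sort (· ≥ ·) ++ P.reverseColumnsWord k

theorem mem_rowBoxes (T : Filling) (k : ℕ) (b : ℕ × ℕ) :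
    b ∈ T.rowBoxes k ↔ b ∈ T.cells ∧ b.1 = k := by
  simp only [rowBoxes, List.mem_map, List.mem_filter, List.mem_range, decide_eq_true_eq]
  constructor
  · rintro ⟨i, ⟨_, h⟩, rfl⟩
    exact ⟨h, rfl⟩
  · rintro ⟨h, rfl⟩
    exact ⟨b.2, ⟨Nat.lt_succ_of_le (Finset.le_sup (f := Prod.snd) h), h⟩, rfl⟩

theorem pairwise_rowBoxes (T : Filling) (k : ℕ) :
    (T.rowBoxes k).Pairwise fun a b => a.2 < b.2 := by
  unfold rowBoxes
  rw [List.pairwise_map]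
  exact List.Pairwise.filter _ List.pairwise_lt_range

theorem mem_rowsList (T : Filling) (m : ℕ) (b : ℕ × ℕ) :
    b ∈ T.rowsList m ↔ b ∈ T.cells ∧ b.1 < m := by
  induction m with
  | zero => simp [rowsList]
  | succ k ih =>
    rw [rowsList, List.mem_append, ih, mem_rowBoxes, ← and_or_left]
    exact and_congr_right fun _ => by omega

/-- The box `a` is read before the box `b` in the row reading order. -/
def RowReadBefore (a b : ℕ × ℕ) : Prop := b.1 < a.1 ∨ a.1 = b.1 ∧ a.2 < b.2

theorem pairwise_rowsList (T : Filling) (m : ℕ) : (T.rowsList m).Pairwise RowReadBefore := by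
  induction m with
  | zero => simp [rowsList]
  | succ k ih =>
    rw [rowsList, List.pairwise_append]
    refine ⟨?_, ih, ?_⟩
    · refine (pairwise_rowBoxes T k).imp_of_mem ?_
      intro a b ha hb hab
      exact Or.inr ⟨((mem_rowBoxes T k a).1 ha).2.trans ((mem_rowBoxes T k b).1 hb).2.symm, hab⟩
    · intro a ha b hb
      have h1 := ((mem_rowBoxes T k a).1 ha).2
      have h2 := ((mem_rowsList T k b).1 hb).2
      exact Or.inl (by omega)

theorem mem_conjugate (T : Filling) (i j : ℕ) : (i, j) ∈ T.conjugate.cells ↔ (j, i) ∈ T.cells := by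
  simp only [conjugate, Finset.mem_image, Prod.exists, Prod.swap_prod_mk, Prod.mk.injEq]
  constructor
  · rintro ⟨a, b, h, rfl, rfl⟩
    exact h
  · exact fun h => ⟨j, i, h, rfl, rfl⟩

theorem sort_ge_eq_of_pairwise_gt {S : Finset ℕ} {l : List ℕ} (h : l.Pairwise (· > ·))
    (hm : ∀ x, x ∈ l ↔ x ∈ S) : l = S.sort (· ≥ ·) :=
  h.eq_of_mem_iff (pairwise_gt_sort S) fun x => by simp [hm]

theorem reverseColumnsWord_conjugate {T : Filling} (hT : T.IsDecreasing) (m : ℕ) :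
    T.conjugate.reverseColumnsWord m = (T.rowsList m).map T.entry := by
  induction m with
  | zero => rfl
  | succ k ih =>
    rw [reverseColumnsWord, rowsList, List.map_append, ih]
    congr 1
    symm
    refine sort_ge_eq_of_pairwise_gt ?_ fun x => ?_
    · rw [List.pairwise_map]
      refine (pairwise_rowBoxes T k).imp_of_mem ?_
      intro a b ha hb hab
      rw [mem_rowBoxes] at ha hb
      exact hT.2.1 a ha.1 b hb.1 (ha.2.trans hb.2.symm) hab
    · rw [mem_column]
      simp only [List.mem_map, mem_rowBoxes, mem_conjugate]
      constructor
      · rintro ⟨b, ⟨h, rfl⟩, rfl⟩; exact ⟨b.2, h, rfl⟩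
      · rintro ⟨i, h, rfl⟩; exact ⟨(k, i), ⟨h, rfl⟩, rfl⟩

theorem HasPartitionShape.mem {T : Filling} (hs : T.HasPartitionShape) {i j i' j' : ℕ}
    (h : (i', j') ∈ T.cells) (hi : i ≤ i') (hj : j ≤ j') : (i, j) ∈ T.cells := by
  obtain ⟨μ, hμ⟩ := hs
  rw [hμ] at h ⊢
  exact mem_of_le h hi hj

theorem IsDecreasing.entry_le {T : Filling} (hT : T.IsDecreasing) (hs : T.HasPartitionShape)
    {a b : ℕ × ℕ} (hb : b ∈ T.cells) (h1 : a.1 ≤ b.1) (h2 : a.2 ≤ b.2) :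
    T.entry b ≤ T.entry a := by
  obtain ⟨a1, a2⟩ := a
  obtain ⟨b1, b2⟩ := b
  simp only at h1 h2
  have hc : (a1, b2) ∈ T.cells := hs.mem hb h1 le_rfl
  have ha : (a1, a2) ∈ T.cells := hs.mem hb h1 h2
  have h3 : T.entry (b1, b2) ≤ T.entry (a1, b2) := by
    rcases h1.eq_or_lt with rfl | h
    · exact le_rfl
    · exact (hT.2.2 _ hc _ hb rfl h).le
  have h4 : T.entry (a1, b2) ≤ T.entry (a1, a2) := by
    rcases h2.eq_or_lt with rfl | h
    · exact le_rfl
    · exact (hT.2.1 _ ha _ hc rfl h).le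
  exact h3.trans h4

/-- Moves the boxes of a list to the right so that their columns become weakly increasing. -/
def pushRight : ℕ → List (ℕ × ℕ) → List (ℕ × ℕ)
  | _, [] => []
  | c, b :: l => (b.1, max c b.2) :: pushRight (max c b.2) l

theorem length_pushRight (l : List (ℕ × ℕ)) : ∀ c, (pushRight c l).length = l.length := by
  induction l with
  | nil => exact fun c => rfl
  | cons b l ih => exact fun c => congrArg (· + 1) (ih _)

/-- The given boxes climb from row to row with increasing entries. A box pushed right to column `c`
stays in the partition shape because it lies above `(r, c)`, and for the same reason its entry still
exceeds that of `(r, c)`. Afterwards the boxes are in column reading order. -/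
theorem pushRight_spec {T : Filling} (hT : T.IsDecreasing) (hs : T.HasPartitionShape)
    (l : List (ℕ × ℕ)) : ∀ r c, (r, c) ∈ T.cells →
    (∀ b ∈ l, b ∈ T.cells ∧ b.1 < r ∧ T.entry (r, c) < T.entry b) →
    l.Pairwise (fun a b => b.1 < a.1 ∧ T.entry a < T.entry b) →
    (∀ a ∈ pushRight c l, a ∈ T.cells ∧ ∃ b ∈ l, T.entry a ≤ T.entry b) ∧
    ((r, c) :: pushRight c l).Pairwise
      fun a b => b.1 < a.1 ∧ a.2 ≤ b.2 ∧ T.entry a < T.entry b := by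
  induction l with
  | nil => intro r c _ _ _; simp [pushRight]
  | cons b l ih =>
    intro r c hrc hl hp
    rw [List.pairwise_cons] at hp
    obtain ⟨hb, hbr, hbe⟩ := hl b (by simp)
    have hx : (b.1, max c b.2) ∈ T.cells := by
      rcases max_cases c b.2 with ⟨h, _⟩ | ⟨h, _⟩
      · rw [h]; exact hs.mem hrc hbr.le le_rfl
      · rw [h]; exact hb
    have hxb : T.entry (b.1, max c b.2) ≤ T.entry b := hT.entry_le hs hx le_rfl (le_max_right _ _)
    have hrx : T.entry (r, c) < T.entry (b.1, max c b.2) := by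
      rcases max_cases c b.2 with ⟨h, _⟩ | ⟨h, _⟩
      · rw [h] at hx ⊢
        exact hT.2.2 _ hx _ hrc rfl hbr
      · rw [h]; exact hbe
    obtain ⟨h1, h2⟩ := ih b.1 (max c b.2) hx (fun b' hb' => ⟨(hl b' (by simp [hb'])).1,
      (hp.1 b' hb').1, hxb.trans_lt (hp.1 b' hb').2⟩) hp.2
    refine ⟨?_, ?_⟩
    · intro a ha
      rcases List.mem_cons.1 ha with rfl | ha
      · exact ⟨hx, b, by simp, hxb⟩
      · obtain ⟨h3, b', hb', h4⟩ := h1 a ha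
        exact ⟨h3, b', by simp [hb'], h4⟩
    · rw [pushRight, List.pairwise_cons]
      refine ⟨?_, h2⟩
      intro a ha
      have h3 : c ≤ max c b.2 := le_max_left _ _
      rcases List.mem_cons.1 ha with rfl | ha
      · exact ⟨hbr, h3, hrx⟩
      · have h4 := (List.pairwise_cons.1 h2).1 a ha
        exact ⟨h4.1.trans hbr, h3.trans h4.2.1, hrx.trans h4.2.2⟩

/-- For partition shape, the row reading word has the same effect on `∅` as the column reading
word. -/
theorem star_rowsList {T : Filling} (hT : T.IsDecreasing) (hs : T.HasPartitionShape) {m : ℕ}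
    (hm : ∀ b ∈ T.cells, b.1 < m) : star ∅ ((T.rowsList m).map T.entry) = star ∅ T.word := by
  rw [word_eq_map]
  refine star_eq_of_weaklyDominated ?_ ?_
  · intro l hl hp
    obtain ⟨l', hl', rfl⟩ := List.sublist_map_iff.1 hl
    rw [List.pairwise_map] at hp
    have hcells : ∀ b ∈ l', b ∈ T.cells := fun b hb => ((mem_rowsList T m b).1 (hl'.subset hb)).1
    -- Rows decrease from left to right, so an increasing subsequence takes at most one box from
    -- each row.
    have hp' : l'.Pairwise fun a b => b.1 < a.1 ∧ T.entry a < T.entry b := by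
      refine (((pairwise_rowsList T m).sublist hl').and hp).imp_of_mem ?_
      rintro a b ha hb ⟨h1 | h1, h2⟩
      · exact ⟨h1, h2⟩
      · have := hT.2.1 a (hcells a ha) b (hcells b hb) h1.1 h1.2
        omega
    cases l' with
    | nil => exact ⟨[], by simp, by simp, rfl, by simp⟩
    | cons b l =>
      rw [List.pairwise_cons] at hp'
      have hb := hcells b (by simp)
      obtain ⟨h1, h2⟩ := pushRight_spec hT hs l b.1 b.2 hb
        (fun b' hb' => ⟨hcells b' (by simp [hb']), hp'.1 b' hb'⟩) hp'.2
      refine ⟨(b :: pushRight b.2 l).map T.entry, List.Sublist.map _ ?_, ?_, ?_, ?_⟩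
      · refine sublist_of_subset_of_pairwise (r := ReadBefore)
          (fun a b h h' => by unfold ReadBefore at h h'; omega) (h2.imp ?_) (pairwise_readList T) ?_
        · intro a b h
          unfold ReadBefore
          omega
        · intro a ha
          rw [mem_readList]
          rcases List.mem_cons.1 ha with rfl | ha
          · exact hb
          · exact (h1 a ha).1
      · rw [List.pairwise_map]
        exact h2.imp fun h => h.2.2
      · simp [length_pushRight]
      · intro x hx
        obtain ⟨a, ha, rfl⟩ := List.mem_map.1 hx
        rcases List.mem_cons.1 ha with rfl | ha
        · exact ⟨T.entry a, by simp, le_rfl⟩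
        · obtain ⟨b', hb', h3⟩ := (h1 a ha).2
          exact ⟨T.entry b', List.mem_map_of_mem (by simp [hb']), h3⟩
  · intro l hl hp
    obtain ⟨l', hl', rfl⟩ := List.sublist_map_iff.1 hl
    refine ⟨l'.map T.entry, List.Sublist.map _ ?_, hp, rfl, fun a ha => ⟨a, ha, le_rfl⟩⟩
    rw [List.pairwise_map] at hp
    have hcells : ∀ b ∈ l', b ∈ T.cells := fun b hb => (mem_readList T b).1 (hl'.subset hb)
    refine sublist_of_subset_of_pairwise (r := RowReadBefore)
      (fun a b h h' => by unfold RowReadBefore at h h'; omega) ?_ (pairwise_rowsList T m) ?_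
    · refine (((pairwise_readList T).sublist hl').and hp).imp_of_mem ?_
      rintro a b ha hb ⟨h1, h2⟩
      left
      -- Conversely the same boxes serve: were `b` not strictly above `a`, it would lie weakly
      -- southeast of `a` and have an entry no larger.
      by_contra h3
      have h4 : a.2 ≤ b.2 := by unfold ReadBefore at h1; omega
      have := hT.entry_le hs (hcells b hb) (not_lt.1 h3) h4
      omega
    · intro b hb
      exact (mem_rowsList T m b).2 ⟨hcells b hb, hm b (hcells b hb)⟩

/-! ### Local equivalences -/

/-- An increasing subsequence takes at most one letter from a decreasing word, so the local
equivalences below involve at most three letters. -/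
theorem sublist_sort_ge {R : Finset ℕ} {l : List ℕ} (h : l.Sublist (R.sort (· ≥ ·)))
    (hl : l.Pairwise (· < ·)) : l = [] ∨ ∃ q ∈ R, l = [q] := by
  have h1 := (pairwise_gt_sort R).sublist h
  match l with
  | [] => exact Or.inl rfl
  | [q] => exact Or.inr ⟨q, by simpa using h.subset (List.mem_singleton_self q), rfl⟩
  | a :: b :: l =>
    have h2 := (List.pairwise_cons.1 hl).1 b (by simp)
    have h3 := (List.pairwise_cons.1 h1).1 b (by simp)
    omega

theorem singleton_sublist_sort_ge {R : Finset ℕ} {q : ℕ} (h : q ∈ R) :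
    [q].Sublist (R.sort (· ≥ ·)) := List.singleton_sublist.2 (by simpa using h)

/-- Reverse insertion of `y` into a decreasing row `R`, with output `y'`. -/
theorem wordEquiv_insert {R R' : Finset ℕ} {y y' : ℕ} (hy' : y' ∈ R) (hlt : y < y')
    (hmin : ∀ q ∈ R, y < q → y' ≤ q) (h : R' = insert y (R.erase y') ∨ R' = R ∧ y ∈ R) :
    WordEquiv ([y] ++ R.sort (· ≥ ·)) (R'.sort (· ≥ ·) ++ [y']) := by
  have hy : y ∈ R' := by
    rcases h with rfl | ⟨rfl, h⟩
    · simp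
    · exact h
  have hR : ∀ q ∈ R, q ∈ R' ∨ q = y' := by
    intro q hq
    rcases h with rfl | ⟨rfl, h⟩
    · by_cases hqy : q = y'
      · exact Or.inr hqy
      · exact Or.inl (by simp [hqy, hq])
    · exact Or.inl hq
  have hR' : ∀ q ∈ R', q ∈ R ∨ q = y := by
    intro q hq
    rcases h with rfl | ⟨rfl, h⟩
    · rcases Finset.mem_insert.1 hq with hq | hq
      · exact Or.inr hq
      · exact Or.inl (Finset.mem_of_mem_erase hq)
    · exact Or.inl hq
  constructor
  · intro l hl hp
    rw [List.sublist_append_iff] at hl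
    obtain ⟨l1, l2, rfl, h1, h2⟩ := hl
    rw [List.pairwise_append] at hp
    rcases List.sublist_singleton.1 h1 with rfl | rfl <;>
      rcases sublist_sort_ge h2 hp.2.1 with rfl | ⟨q, hq, rfl⟩
    · exact ⟨[], by simp, by simp, rfl, by simp⟩
    · rcases hR q hq with h3 | rfl
      · exact ⟨[q], (singleton_sublist_sort_ge h3).trans (List.sublist_append_left _ _), by simp,
          rfl, by simp⟩
      · exact ⟨[q], List.sublist_append_right _ _, by simp, rfl, by simp⟩
    · exact ⟨[y], (singleton_sublist_sort_ge hy).trans (List.sublist_append_left _ _), by simp,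
          rfl, by simp⟩
    · have hyq : y < q := hp.2.2 y (by simp) q (by simp)
      have := hmin q hq hyq
      refine ⟨[y] ++ [y'], (singleton_sublist_sort_ge hy).append (.refl _), by simpa using hlt,
        rfl, ?_⟩
      simp only [List.mem_append, List.mem_singleton]
      rintro a (rfl | rfl)
      · exact ⟨⟨a, by simp, le_rfl⟩, a, by simp, le_rfl⟩
      · exact ⟨⟨y, by simp, hlt.le⟩, q, by simp, this⟩
  · intro l hl hp
    rw [List.sublist_append_iff] at hl
    obtain ⟨l1, l2, rfl, h1, h2⟩ := hl
    rw [List.pairwise_append] at hp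
    rcases List.sublist_singleton.1 h2 with rfl | rfl <;>
      rcases sublist_sort_ge h1 hp.1 with rfl | ⟨q, hq, rfl⟩
    · exact ⟨[], by simp, by simp, rfl, by simp⟩
    · rcases hR' q hq with h3 | rfl
      · exact ⟨[q], (singleton_sublist_sort_ge h3).trans (List.sublist_append_right _ _), by simp,
          rfl, by simp⟩
      · exact ⟨[q], List.sublist_append_left _ _, by simp, rfl, by simp⟩
    · exact ⟨[y'], (singleton_sublist_sort_ge hy').trans (List.sublist_append_right _ _), by simp,
          rfl, by simp⟩
    · have hqy' : q < y' := hp.2.2 q (by simp) y' (by simp)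
      have hqy : q ≤ y := by
        rcases hR' q hq with h3 | rfl
        · by_contra h4
          have := hmin q h3 (by omega)
          omega
        · exact le_rfl
      refine ⟨[y] ++ [y'], (List.Sublist.refl _).append (singleton_sublist_sort_ge hy'),
        by simpa using hlt, rfl, ?_⟩
      simp only [List.mem_append, List.mem_singleton]
      rintro a (rfl | rfl)
      · exact ⟨⟨q, by simp, hqy⟩, y', by simp, hlt.le⟩
      · exact ⟨⟨a, by simp, le_rfl⟩, a, by simp, le_rfl⟩

/-- Reverse insertion of `y` into a row `R` that is not changed since the row `Q` below `R`
contains `y`. -/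
theorem wordEquiv_insert_of_mem {Q R : Finset ℕ} {y y' : ℕ} (hy : y ∈ Q) (hy' : y' ∈ R)
    (hlt : y < y') (hmin : ∀ q ∈ R, y < q → y' ≤ q)
    (hQ : ∀ p ∈ Q, p < y → ∃ q ∈ R, p < q ∧ q < y') :
    WordEquiv (Q.sort (· ≥ ·) ++ ([y] ++ R.sort (· ≥ ·)))
      (Q.sort (· ≥ ·) ++ (R.sort (· ≥ ·) ++ [y'])) := by
  constructor
  · intro l hl hp
    rw [List.sublist_append_iff] at hl
    obtain ⟨l0, l12, rfl, h0, hl⟩ := hl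
    rw [List.sublist_append_iff] at hl
    obtain ⟨l1, l2, rfl, h1, h2⟩ := hl
    rw [List.pairwise_append, List.pairwise_append] at hp
    rcases List.sublist_singleton.1 h1 with rfl | rfl
    · exact ⟨l0 ++ l2, h0.append (h2.trans (List.sublist_append_left _ _)),
        List.pairwise_append.2 ⟨hp.1, hp.2.1.2.1, by simpa using hp.2.2⟩, by simp,
        fun a ha => by exact ⟨⟨a, by simpa using ha, le_rfl⟩, a, by simpa using ha, le_rfl⟩⟩
    · rcases sublist_sort_ge h0 hp.1 with rfl | ⟨p, hpQ, rfl⟩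
      · exact ⟨[y] ++ l2, (singleton_sublist_sort_ge hy).append
          (h2.trans (List.sublist_append_left _ _)), List.pairwise_append.2 hp.2.1, by simp,
          fun a ha => ⟨⟨a, by simpa using ha, le_rfl⟩, a, by simpa using ha, le_rfl⟩⟩
      -- The letter from `Q` is already used for `p`, so `y` cannot be taken there; a letter `q ≤ y`
      -- of `R` takes its place, and `y'` replaces a following letter of `R`.
      · have hpy : p < y := hp.2.2 p (by simp) y (by simp)
        obtain ⟨q, hq, hpq, hqy⟩ := hQ p hpQ hpy
        have hqy : q ≤ y := by
          by_contra h4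
          have := hmin q hq (by omega)
          omega
        rcases sublist_sort_ge h2 hp.2.1.2.1 with rfl | ⟨s, hs, rfl⟩
        · refine ⟨[p] ++ [q], (singleton_sublist_sort_ge hpQ).append
            ((singleton_sublist_sort_ge hq).trans (List.sublist_append_left _ _)),
            by simpa using hpq, rfl, ?_⟩
          simp only [List.mem_append, List.mem_singleton]
          rintro a (rfl | rfl)
          · exact ⟨⟨a, by simp, le_rfl⟩, a, by simp, le_rfl⟩
          · exact ⟨⟨p, by simp, hpq.le⟩, y, by simp, hqy⟩
        · have hys : y < s := hp.2.1.2.2 y (by simp) s (by simp)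
          have := hmin s hs hys
          refine ⟨[p] ++ ([q] ++ [y']), (singleton_sublist_sort_ge hpQ).append
            ((singleton_sublist_sort_ge hq).append (.refl _)), ?_, rfl, ?_⟩
          · simp only [List.cons_append, List.nil_append, List.pairwise_cons, List.mem_cons,
              List.not_mem_nil, or_false]
            refine ⟨?_, ?_, ?_⟩
            · rintro a (rfl | rfl) <;> omega
            · rintro a rfl; omega
            · simp
          · simp only [List.mem_append, List.mem_singleton]
            rintro a (rfl | rfl | rfl)
            · exact ⟨⟨a, by simp, le_rfl⟩, a, by simp, le_rfl⟩
            · exact ⟨⟨p, by simp, hpq.le⟩, y, by simp, hqy⟩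
            · exact ⟨⟨y, by simp, hlt.le⟩, s, by simp, this⟩
  · intro l hl hp
    rw [List.sublist_append_iff] at hl
    obtain ⟨l0, l12, rfl, h0, hl⟩ := hl
    rw [List.sublist_append_iff] at hl
    obtain ⟨l1, l2, rfl, h1, h2⟩ := hl
    rw [List.pairwise_append, List.pairwise_append] at hp
    rcases List.sublist_singleton.1 h2 with rfl | rfl
    · exact ⟨l0 ++ l1, h0.append (h1.trans (List.sublist_append_right _ _)),
        List.pairwise_append.2 ⟨hp.1, hp.2.1.1, by simpa using hp.2.2⟩, by simp,
        fun a ha => by exact ⟨⟨a, by simpa using ha, le_rfl⟩, a, by simpa using ha, le_rfl⟩⟩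
    · rcases sublist_sort_ge h1 hp.2.1.1 with rfl | ⟨q, hq, rfl⟩
      · refine ⟨l0 ++ [y'], h0.append ((singleton_sublist_sort_ge hy').trans
          (List.sublist_append_right _ _)), List.pairwise_append.2 ⟨hp.1, by simp,
          by simpa using hp.2.2⟩, by simp, fun a ha => ?_⟩
        exact ⟨⟨a, by simpa using ha, le_rfl⟩, a, by simpa using ha, le_rfl⟩
      · have hqy' : q < y' := hp.2.1.2.2 q (by simp) y' (by simp)
        have hqy : q ≤ y := by
          by_contra h4
          have := hmin q hq (by omega)
          omega
        refine ⟨l0 ++ ([y] ++ [y']), h0.append ((List.Sublist.refl _).append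
          (singleton_sublist_sort_ge hy')), List.pairwise_append.2 ⟨hp.1, by simpa using hlt, ?_⟩,
          by simp, ?_⟩
        · intro a ha b hb
          have := hp.2.2 a ha q (by simp)
          simp only [List.mem_append, List.mem_singleton] at hb
          omega
        · simp only [List.mem_append, List.mem_singleton]
          rintro a (ha | rfl | rfl)
          · exact ⟨⟨a, by simp [ha], le_rfl⟩, a, by simp [ha], le_rfl⟩
          · exact ⟨⟨q, by simp, hqy⟩, y', by simp, hlt.le⟩
          · exact ⟨⟨a, by simp, le_rfl⟩, a, by simp, le_rfl⟩

/-! ### Reverse Hecke column insertion -/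

/-- The value `y`, on its way into column `k`, comes from a row `d` of column `k + 1`. -/
def ComesFrom (P : Filling) (k y : ℕ) : Prop :=
  ∃ d, (d, k) ∈ P.cells ∧ y < P.entry (d, k) ∧
    (∀ c, d < c → (c, k + 1) ∈ P.cells → P.entry (c, k + 1) < y) ∧
    ((d, k + 1) ∈ P.cells → P.entry (d, k + 1) ≤ y)

/-- One step of the reverse insertion. -/
theorem reverseInsert_succ (P : Filling) {k y : ℕ} (h : ∃ x ∈ P.column k, y < x) :
    ∃ y' ∈ P.column k, y < y' ∧ (∀ x ∈ P.column k, y < x → y' ≤ x) ∧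
      ∃ P₁ : Filling, P₁ =
        (if ({ cells := P.cells
               entry := fun b => if b.2 = k ∧ P.entry b = y' then y else P.entry b } :
                Filling).IsDecreasing
          then { cells := P.cells
                 entry := fun b => if b.2 = k ∧ P.entry b = y' then y else P.entry b } else P) ∧
        P₁.cells = P.cells ∧ (∀ b, b.2 ≠ k → P₁.entry b = P.entry b) ∧
        reverseInsert (k + 1) y P = reverseInsert k y' P₁ := by
  have hne : ((P.column k).filter fun x => y < x).Nonempty := by
    obtain ⟨x, hx, hxy⟩ := h
    exact ⟨x, by simp [hx, hxy]⟩
  have hmem := Finset.mem_filter.1 (Finset.min'_mem _ hne)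
  refine ⟨((P.column k).filter fun x => y < x).min' hne, hmem.1, hmem.2,
    fun x hx hxy => Finset.min'_le _ _ (by simp [hx, hxy]), _, rfl, ?_, ?_, ?_⟩
  · split_ifs <;> rfl
  · intro b hb
    split_ifs
    · exact if_neg fun h1 => hb h1.1
    · rfl
  · rw [reverseInsert, dif_pos hne]

/-- The two possible effects of a step of the reverse insertion on the column it meets. -/
theorem reverseInsert_step {P : Filling} (hs : P.HasPartitionShape) (hP : P.IsDecreasing)
    {k y : ℕ} (hy : 0 < y) (hc : P.ComesFrom k y) :
    ∃ c y', (c, k) ∈ P.cells ∧ P.entry (c, k) = y' ∧ y < y' ∧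
      (∀ x ∈ P.column k, y < x → y' ≤ x) ∧
      ∃ P₁ : Filling, P₁.cells = P.cells ∧ P₁.IsDecreasing ∧
        (∀ b, b.2 ≠ k → P₁.entry b = P.entry b) ∧
        (∀ i, c < i → (i, k) ∈ P.cells → P₁.entry (i, k) < y') ∧ P₁.entry (c, k) ≤ y' ∧
        reverseInsert (k + 1) y P = reverseInsert k y' P₁ ∧
        (P₁.column k = insert y ((P.column k).erase y') ∨
          P₁ = P ∧ (y ∈ P.column k ∨ (c, k + 1) ∈ P.cells ∧ P.entry (c, k + 1) = y)) := by
  obtain ⟨d, hd, hyd, hbelow, hdle⟩ := hc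
  obtain ⟨y', hy', hlt, hmin, P₁, hP₁, hcells, hother, hrec⟩ :=
    reverseInsert_succ P (k := k) (y := y) ⟨_, (mem_column _ _ _).2 ⟨d, hd, rfl⟩, hyd⟩
  obtain ⟨c, hcP, hce⟩ := (mem_column _ _ _).1 hy'
  have hdc : d ≤ c := by
    by_contra h1
    have h2 := (hP.column_lt_iff hd hcP).2 (not_le.1 h1)
    have := hmin _ ((mem_column _ _ _).2 ⟨d, hd, rfl⟩) hyd
    omega
  have huniq : ∀ b ∈ P.cells, b.2 = k → P.entry b = y' → b = (c, k) := by
    rintro ⟨i, j⟩ hb hj he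
    obtain rfl : j = k := hj
    have h1 := hP.column_lt_iff hb hcP
    have h2 := hP.column_lt_iff hcP hb
    rw [Prod.mk.injEq]
    omega
  have hlower : ∀ i, c < i → (i, k) ∈ P.cells → P.entry (i, k) < y' := fun i hi hb => by
    rw [← hce]; exact (hP.column_lt_iff hb hcP).2 hi
  refine ⟨c, y', hcP, hce, hlt, hmin, P₁, hcells, ?_⟩
  by_cases hdec : ({ cells := P.cells
                     entry := fun b => if b.2 = k ∧ P.entry b = y' then y else P.entry b } :
                Filling).IsDecreasing
  · rw [if_pos hdec] at hP₁
    subst hP₁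
    refine ⟨hdec, hother, ?_, ?_, hrec, Or.inl ?_⟩
    · intro i hi hb
      have := hlower i hi hb
      show (if _ ∧ _ then _ else _) < y'
      split_ifs <;> omega
    · show (if _ ∧ _ then _ else _) ≤ y'
      split_ifs <;> omega
    · ext x
      simp only [mem_column, Finset.mem_insert, Finset.mem_erase]
      constructor
      · rintro ⟨i, hi, rfl⟩
        by_cases h1 : P.entry (i, k) = y'
        · left; simp [h1]
        · right
          rw [if_neg (by simp [h1])]
          exact ⟨h1, i, hi, rfl⟩
      · rintro (rfl | ⟨hne, i, hi, rfl⟩)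
        · exact ⟨c, hcP, by simp [hce]⟩
        · exact ⟨i, hi, by simp [hne]⟩
  · rw [if_neg hdec] at hP₁
    subst hP₁
    refine ⟨hP, hother, hlower, hce.le, hrec, Or.inr ⟨rfl, ?_⟩⟩
    -- If `y` is neither in the column nor the right neighbour of `y'`, every comparison at the box
    -- `(c, k)` is strict after the replacement, and the result would be decreasing.
    by_contra hcon
    rw [not_or, not_and] at hcon
    obtain ⟨hyk, hyr⟩ := hcon
    have hright : (c, k + 1) ∈ P₁.cells → P₁.entry (c, k + 1) < y := by
      intro h1
      rcases hdc.eq_or_lt with rfl | h2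
      · exact lt_of_le_of_ne (hdle h1) (hyr h1)
      · exact hbelow c h2 h1
    have hval : ∀ b ∈ P₁.cells, b ≠ (c, k) →
        (if b.2 = k ∧ P₁.entry b = y' then y else P₁.entry b) = P₁.entry b := fun b hb hne =>
      if_neg fun h1 => hne (huniq b hb h1.1 h1.2)
    have hvalc : (if ((c, k) : ℕ × ℕ).2 = k ∧ P₁.entry (c, k) = y' then y
        else P₁.entry (c, k)) = y := if_pos ⟨rfl, hce⟩
    refine hdec ⟨?_, ?_, ?_⟩
    · intro a ha
      show 0 < (if _ ∧ _ then _ else _)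
      split_ifs
      · exact hy
      · exact hP.1 a ha
    · intro a ha b hb hab hlt2
      show (if _ ∧ _ then _ else _) < (if _ ∧ _ then _ else _)
      by_cases h1 : a = (c, k)
      · subst h1
        rw [hvalc, hval b hb (by rintro rfl; simp at hlt2)]
        obtain ⟨i, j⟩ := b
        simp only at hab hlt2
        subst hab
        have h2 : (c, k + 1) ∈ P₁.cells := hs.mem hb le_rfl hlt2
        exact (hP.entry_le hs (a := (c, k + 1)) hb le_rfl hlt2).trans_lt (hright h2)
      · rw [hval a ha h1]
        have h3 := hP.2.1 a ha b hb hab hlt2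
        by_cases h2 : b = (c, k)
        · subst h2
          rw [hvalc]
          omega
        · rw [hval b hb h2]
          exact h3
    · intro a ha b hb hab hlt2
      show (if _ ∧ _ then _ else _) < (if _ ∧ _ then _ else _)
      have h3 := hP.2.2 a ha b hb hab hlt2
      by_cases h1 : a = (c, k)
      · subst h1
        rw [hvalc, hval b hb (by rintro rfl; simp at hlt2)]
        obtain ⟨i, j⟩ := b
        simp only at hab hlt2
        subst hab
        have h4 : P₁.entry (i, k) ∈ P₁.column k := (mem_column _ _ _).2 ⟨i, hb, rfl⟩
        by_contra h5
        rcases (not_lt.1 h5).eq_or_lt with h6 | h6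
        · exact hyk (h6 ▸ h4)
        · have := hmin _ h4 h6
          omega
      · rw [hval a ha h1]
        by_cases h2 : b = (c, k)
        · subst h2
          rw [hvalc]
          omega
        · rw [hval b hb h2]
          exact h3

theorem reverseColumnsWord_congr {P P' : Filling} {m : ℕ} (h : ∀ j < m, P.column j = P'.column j) :
    P.reverseColumnsWord m = P'.reverseColumnsWord m := by
  induction m with
  | zero => rfl
  | succ m ih =>
    rw [reverseColumnsWord, reverseColumnsWord, h m (by omega), ih fun j hj => h j (by omega)]

theorem column_congr {P P' : Filling} {j : ℕ}
    (hc : ∀ i, (i, j) ∈ P.cells ↔ (i, j) ∈ P'.cells)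
    (he : ∀ i, (i, j) ∈ P.cells → P.entry (i, j) = P'.entry (i, j)) : P.column j = P'.column j := by
  ext x
  simp only [mem_column]
  refine exists_congr fun i => ?_
  rw [← hc]
  exact and_congr_right fun h => by rw [he i h]

theorem HasPartitionShape.congr {P P' : Filling} (h : P.HasPartitionShape)
    (hc : P'.cells = P.cells) : P'.HasPartitionShape := by
  obtain ⟨μ, hμ⟩ := h
  exact ⟨μ, hc.trans hμ⟩

theorem ComesFrom.of_step {P₁ : Filling} (hs : P₁.HasPartitionShape)
    {c k y' e : ℕ} (hc : (c, k + 1) ∈ P₁.cells) (he : P₁.entry (c, k) = e) (hlt : y' < e)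
    (hbelow : ∀ i, c < i → (i, k + 1) ∈ P₁.cells → P₁.entry (i, k + 1) < y')
    (hle : P₁.entry (c, k + 1) ≤ y') : P₁.ComesFrom k y' :=
  ⟨c, hs.mem hc le_rfl (by omega), by rw [he]; exact hlt, hbelow, fun _ => hle⟩

/-- Column `k` is carried along as a context: if the column to its left stays unchanged because the
right neighbour of `y'` is `y`, the equivalence holds only next to the column that contains this
`y`. -/
theorem reverseInsert_spec : ∀ (k : ℕ) (P : Filling) (y : ℕ), P.HasPartitionShape →
    P.IsDecreasing → 0 < y → (∀ j, k = j + 1 → P.ComesFrom j y) →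
    (reverseInsert k y P).1.cells = P.cells ∧ (reverseInsert k y P).1.IsDecreasing ∧
    (∀ b, k ≤ b.2 → (reverseInsert k y P).1.entry b = P.entry b) ∧
    WordEquiv ((P.column k).sort (· ≥ ·) ++ ([y] ++ P.reverseColumnsWord k))
      ((P.column k).sort (· ≥ ·) ++ ((reverseInsert k y P).1.reverseColumnsWord k ++
        [(reverseInsert k y P).2])) := by
  intro k
  induction k with
  | zero =>
    intro P y _ hP _ _
    refine ⟨rfl, hP, fun _ _ => rfl, ?_⟩
    simp only [reverseInsert, reverseColumnsWord, List.append_nil, List.nil_append]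
    exact .refl _
  | succ k ih =>
    intro P y hs hP hy hc
    obtain ⟨c, y', hcP, hce, hlt, hmin, P₁, hcells, hP₁, hother, hlower, hle, hrec, hcase⟩ :=
      reverseInsert_step hs hP hy (hc k rfl)
    have hy'mem : y' ∈ P.column k := (mem_column _ _ _).2 ⟨c, hcP, hce⟩
    have hs₁ : P₁.HasPartitionShape := hs.congr hcells
    have hc₁ : ∀ j, k = j + 1 → P₁.ComesFrom j y' := by
      rintro j rfl
      refine .of_step hs₁ (hcells ▸ hcP) rfl ?_ (fun i hi hb => hlower i hi (hcells ▸ hb)) hle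
      rw [hother _ (by simp), ← hce]
      exact hP.2.1 _ (hs.mem hcP le_rfl (by omega)) _ hcP rfl (by simp)
    obtain ⟨h1, h2, h3, h4⟩ := ih P₁ y' hs₁ hP₁ (by omega) hc₁
    rw [hrec]
    refine ⟨h1.trans hcells, h2, ?_, ?_⟩
    · intro b hb
      rw [h3 b (by omega), hother b (by omega)]
    · set r := reverseInsert k y' P₁
      have e1 : r.1.column k = P₁.column k :=
        column_congr (fun i => by rw [h1]) fun i _ => h3 _ le_rfl
      have e2 : P₁.reverseColumnsWord k = P.reverseColumnsWord k :=
        reverseColumnsWord_congr fun j hj => column_congr (fun i => by rw [hcells])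
          fun i _ => hother _ (by simp only; omega)
      have key : WordEquiv ((P.column (k + 1)).sort (· ≥ ·) ++
          ([y] ++ (P.column k).sort (· ≥ ·)))
          ((P.column (k + 1)).sort (· ≥ ·) ++ ((P₁.column k).sort (· ≥ ·) ++ [y'])) := by
        rcases hcase with hcase | ⟨rfl, hcase | hcase⟩
        · exact (WordEquiv.refl _).append
            (wordEquiv_insert hy'mem hlt hmin (Or.inl hcase))
        · exact (WordEquiv.refl _).append
            (wordEquiv_insert hy'mem hlt hmin (Or.inr ⟨rfl, hcase⟩))
        · refine wordEquiv_insert_of_mem ((mem_column _ _ _).2 ⟨c, hcase⟩) hy'mem hlt hmin ?_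
          -- An entry `p < y` of column `k + 1` lies below row `c`; its left neighbour is larger
          -- than `p` and, being below `y'`, smaller than `y'`.
          intro p hp hpy
          obtain ⟨i, hi, rfl⟩ := (mem_column _ _ _).1 hp
          have hci : c < i := by
            rw [← hP.column_lt_iff hi hcase.1, hcase.2]; exact hpy
          have hi' : (i, k) ∈ P₁.cells := hs.mem hi le_rfl (by omega)
          exact ⟨_, (mem_column _ _ _).2 ⟨i, hi', rfl⟩, hP.2.1 _ hi' _ hi rfl (by simp),
            hlower i hci hi'⟩
      rw [reverseColumnsWord, reverseColumnsWord, e1]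
      have f1 := key.append (.refl (P.reverseColumnsWord k))
      have f2 := (WordEquiv.refl ((P.column (k + 1)).sort (· ≥ ·))).append h4
      rw [e2] at f2
      simp only [List.append_assoc] at f1 f2 ⊢
      exact f1.trans f2

/-- Two consecutive reverse insertions: the second output is smaller than the first one. -/
theorem reverseInsert_snd_lt : ∀ (k : ℕ) (P : Filling) (a b : ℕ) (R : Filling) (d : ℕ),
    P.HasPartitionShape → P.IsDecreasing → 0 < a → (∀ j, k = j + 1 → P.ComesFrom j a) →
    (d, k) ∈ P.cells → P.entry (d, k) = b → b < a →
    (∀ i j, j < k → ((i, j) ∈ R.cells ↔ (i, j) ∈ P.cells)) →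
    (∀ i j, j < k → R.entry (i, j) = (reverseInsert k a P).1.entry (i, j)) →
    (reverseInsert k b R).2 < (reverseInsert k a P).2 := by
  intro k
  induction k with
  | zero => intro P a b R d _ _ _ _ _ _ hba _ _; exact hba
  | succ k ih =>
    intro P a b R d hs hP ha hc hd hdb hba hRc hRe
    obtain ⟨c, a', hcP, hce, hlt, hmin, P₁, hcells, hP₁, hother, hlower, hle, hrec, hcase⟩ :=
      reverseInsert_step hs hP ha (hc k rfl)
    have hs₁ : P₁.HasPartitionShape := hs.congr hcells
    have hc₁ : ∀ j, k = j + 1 → P₁.ComesFrom j a' := by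
      rintro j rfl
      refine .of_step hs₁ (hcells ▸ hcP) rfl ?_ (fun i hi hb => hlower i hi (hcells ▸ hb)) hle
      rw [hother _ (by simp), ← hce]
      exact hP.2.1 _ (hs.mem hcP le_rfl (by omega)) _ hcP rfl (by simp)
    obtain ⟨h1, h2, h3, -⟩ := reverseInsert_spec k P₁ a' hs₁ hP₁ (by omega) hc₁
    rw [hrec] at hRe ⊢
    have hRcol : R.column k = P₁.column k := by
      refine column_congr (fun i => by rw [hRc i k (by omega), hcells]) fun i _ => ?_
      rw [hRe i k (by omega), h3 _ le_rfl]
    have hdk : (d, k) ∈ P₁.cells := hcells ▸ hs.mem hd le_rfl (by omega)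
    have hdk' : b < P₁.entry (d, k) := by
      rw [← hdb, ← hother (d, k + 1) (by simp)]
      exact hP₁.2.1 _ hdk _ (hcells ▸ hd) rfl (by simp)
    have hdmem : P₁.entry (d, k) ∈ R.column k := hRcol ▸ (mem_column _ _ _).2 ⟨d, hdk, rfl⟩
    obtain ⟨b', hb', hlt', hmin', R₁, -, hRcells, hRother, hRrec⟩ :=
      reverseInsert_succ R (k := k) (y := b) ⟨_, hdmem, hdk'⟩
    rw [hRrec]
    -- If `a` lies in the column after the first insertion, then `b' ≤ a < a'`. Otherwise `a` is the
    -- right neighbour of `a'`, the box of `b` is lower, and its left neighbour bounds `b'` and is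
    -- below `a'`.
    have hb'a' : b' < a' := by
      rcases hcase with hcase | ⟨rfl, hcase | hcase⟩
      · have := hmin' a (by rw [hRcol, hcase]; simp) hba
        omega
      · have := hmin' a (by rw [hRcol]; exact hcase) hba
        omega
      · have h4 : c < d := by
          rw [← hP.column_lt_iff hd hcase.1, hcase.2, hdb]; exact hba
        have h5 := hlower d h4 hdk
        have := hmin' _ hdmem hdk'
        omega
    rw [hRcol] at hb'
    obtain ⟨d', hd', hde'⟩ := (mem_column _ _ _).1 hb'
    refine ih P₁ a' b' R₁ d' hs₁ hP₁ (by omega) hc₁ hd' hde' hb'a' ?_ ?_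
    · intro i j hj
      rw [hRcells, hRc i j (by omega), hcells]
    · intro i j hj
      rw [hRother _ (by simp only; omega), hRe i j (by omega)]

theorem bottomBox_spec {P : Filling} {k : ℕ} (h : ∃ i, (i, k) ∈ P.cells) :
    P.bottomBox k ∈ P.cells ∧ ∀ i, (i, k) ∈ P.cells → i ≤ (P.bottomBox k).1 := by
  obtain ⟨i, hi⟩ := h
  have hne : (P.columnCells k).Nonempty := ⟨(i, k), by simp [columnCells, hi]⟩
  obtain ⟨b, hb, hb'⟩ := Finset.exists_mem_eq_sup _ hne Prod.fst
  have hb2 := Finset.mem_filter.1 hb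
  refine ⟨?_, fun i' hi' => ?_⟩
  · show ((P.columnCells k).sup Prod.fst, k) ∈ P.cells
    rw [hb', ← hb2.2]
    exact hb2.1
  · exact Finset.le_sup (f := Prod.fst) (b := (i', k)) (by simp [columnCells, hi'])

/-- The tableaux met in `reverseHeckeOutputs m P`. -/
structure CanReverse (P : Filling) (m : ℕ) : Prop where
  shape : P.HasPartitionShape
  isDecreasing : P.IsDecreasing
  nonempty : ∀ k, m = k + 1 → ∃ i, (i, k) ∈ P.cells
  -- Column `m` is strictly shorter than column `m - 1`, so the lowest box of the latter ends its
  -- row and can be removed.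
  last : ∀ i k, m = k + 1 → (i, k + 1) ∈ P.cells → (i + 1, k) ∈ P.cells

namespace CanReverse

variable {P : Filling} {k : ℕ}

/-- `P` without the lowest box of column `k`. -/
def eraseBottom (P : Filling) (k : ℕ) : Filling where
  cells := P.cells.erase (P.bottomBox k)
  entry := P.entry

theorem mem_eraseBottom (P : Filling) (k i j : ℕ) : (i, j) ∈ (eraseBottom P k).cells ↔
    ((i, j) ≠ P.bottomBox k) ∧ (i, j) ∈ P.cells := Finset.mem_erase

theorem eraseBottom_facts (h : CanReverse P (k + 1)) :
    (eraseBottom P k).HasPartitionShape ∧ (eraseBottom P k).IsDecreasing ∧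
      0 < P.entry (P.bottomBox k) ∧
      (∀ j, k = j + 1 → (eraseBottom P k).ComesFrom j (P.entry (P.bottomBox k))) ∧
      (P.column k).sort (· ≥ ·) =
        ((eraseBottom P k).column k).sort (· ≥ ·) ++ [P.entry (P.bottomBox k)] ∧
      (∀ x ∈ (eraseBottom P k).column k, P.entry (P.bottomBox k) < x) := by
  obtain ⟨hb, hmax⟩ := bottomBox_spec (h.nonempty k rfl)
  obtain ⟨i₀, hi₀⟩ : ∃ i₀, P.bottomBox k = (i₀, k) := ⟨_, rfl⟩
  rw [hi₀] at hb hmax ⊢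
  simp only at hmax
  have hmem : ∀ i j, (i, j) ∈ (eraseBottom P k).cells ↔ (i, j) ≠ (i₀, k) ∧ (i, j) ∈ P.cells := by
    intro i j; rw [mem_eraseBottom, hi₀]
  have hsub : ∀ b ∈ (eraseBottom P k).cells, b ∈ P.cells := fun b hb => Finset.mem_of_mem_erase hb
  have hgt : ∀ x ∈ (eraseBottom P k).column k, P.entry (i₀, k) < x := by
    intro x hx
    obtain ⟨i, hi, rfl⟩ := (mem_column _ _ _).1 hx
    have h1 := (hmem i k).1 hi
    show _ < P.entry (i, k)
    rw [h.isDecreasing.column_lt_iff hb h1.2]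
    refine lt_of_le_of_ne (hmax i h1.2) ?_
    rintro rfl
    exact h1.1 rfl
  refine ⟨⟨⟨(eraseBottom P k).cells, isLowerSet_of_pred ?_ ?_⟩, rfl⟩, ⟨?_, ?_, ?_⟩,
    h.isDecreasing.1 _ hb, ?_, ?_, hgt⟩
  · intro i j hij
    rw [hmem] at hij ⊢
    refine ⟨?_, h.shape.mem hij.2 (by omega) le_rfl⟩
    intro e
    obtain ⟨rfl, rfl⟩ := Prod.mk.inj e
    have := hmax _ hij.2
    omega
  · intro i j hij
    rw [hmem] at hij ⊢
    refine ⟨?_, h.shape.mem hij.2 le_rfl (by omega)⟩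
    intro e
    obtain ⟨rfl, rfl⟩ := Prod.mk.inj e
    have := hmax _ (h.last i j rfl hij.2)
    omega
  · exact fun a ha => h.isDecreasing.1 a (hsub a ha)
  · exact fun a ha b hb => h.isDecreasing.2.1 a (hsub a ha) b (hsub b hb)
  · exact fun a ha b hb => h.isDecreasing.2.2 a (hsub a ha) b (hsub b hb)
  · rintro j rfl
    have h1 : (i₀, j) ∈ P.cells := h.shape.mem hb le_rfl (by omega)
    -- The row of the removed box is the witness: nothing is left in its column in this row or
    -- below.
    refine ⟨i₀, (hmem _ _).2 ⟨by simp, h1⟩, h.isDecreasing.2.1 _ h1 _ hb rfl (by simp), ?_, ?_⟩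
    · intro c hc hcm
      have := hmax c ((hmem _ _).1 hcm).2
      omega
    · intro hcm
      exact absurd rfl ((hmem _ _).1 hcm).1
  · symm
    refine sort_ge_eq_of_pairwise_gt ?_ fun x => ?_
    · rw [List.pairwise_append]
      refine ⟨pairwise_gt_sort _, by simp, fun a ha b hb => ?_⟩
      rw [List.mem_singleton.1 hb]
      exact hgt a (by simpa using ha)
    · simp only [List.mem_append, Finset.mem_sort, List.mem_singleton, mem_column, hmem]
      constructor
      · rintro (⟨i, hi, rfl⟩ | rfl)
        · exact ⟨i, hi.2, rfl⟩
        · exact ⟨i₀, hb, rfl⟩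
      · rintro ⟨i, hi, rfl⟩
        by_cases h1 : i = i₀
        · subst h1; exact Or.inr rfl
        · exact Or.inl ⟨i, ⟨by simp [h1], hi⟩, rfl⟩

theorem reverseHecke_eq (P : Filling) (k : ℕ) : reverseHecke P (P.bottomBox k) true =
    reverseInsert k (P.entry (P.bottomBox k)) (eraseBottom P k) := rfl

theorem next (h : CanReverse P (k + 1)) :
    CanReverse (reverseHecke P (P.bottomBox k) true).1 k ∧
    (∀ j < k, ∀ i, (i, j) ∈ (reverseHecke P (P.bottomBox k) true).1.cells ↔ (i, j) ∈ P.cells) ∧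
    WordEquiv (P.reverseColumnsWord (k + 1)) (((eraseBottom P k).column k).sort (· ≥ ·) ++
      ((reverseHecke P (P.bottomBox k) true).1.reverseColumnsWord k ++
        [(reverseHecke P (P.bottomBox k) true).2])) := by
  obtain ⟨h1, h2, h3, h4, h5, -⟩ := h.eraseBottom_facts
  obtain ⟨hb, hmax⟩ := bottomBox_spec (h.nonempty k rfl)
  obtain ⟨g1, g2, g3, g4⟩ := reverseInsert_spec k (eraseBottom P k) _ h1 h2 h3 h4
  rw [← reverseHecke_eq] at g1 g2 g3 g4
  have hcell : ∀ j < k, ∀ i, (i, j) ∈ (reverseHecke P (P.bottomBox k) true).1.cells ↔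
      (i, j) ∈ P.cells := by
    intro j hj i
    rw [g1, mem_eraseBottom]
    refine and_iff_right fun e => ?_
    have := congrArg Prod.snd e
    simp only [bottomBox] at this
    omega
  refine ⟨⟨h1.congr g1, g2, ?_, ?_⟩, hcell, ?_⟩
  · rintro j rfl
    refine ⟨(P.bottomBox (j + 1)).1, (hcell j (by omega) _).2 ?_⟩
    exact h.shape.mem (i' := (P.bottomBox (j + 1)).1) (j' := j + 1) hb le_rfl (by omega)
  · rintro i j rfl hi
    rw [hcell j (by omega)]
    rw [g1, mem_eraseBottom] at hi
    have h6 := hmax i hi.2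
    have h7 : i ≠ (P.bottomBox (j + 1)).1 := by
      rintro rfl
      exact hi.1 rfl
    exact h.shape.mem (i' := (P.bottomBox (j + 1)).1) (j' := j + 1) hb (by omega) (by omega)
  · rw [reverseColumnsWord, h5]
    have e : P.reverseColumnsWord k = (eraseBottom P k).reverseColumnsWord k :=
      reverseColumnsWord_congr fun j hj => column_congr (fun i => by
        rw [mem_eraseBottom]
        refine (and_iff_right fun e => ?_).symm
        have := congrArg Prod.snd e
        simp only [bottomBox] at this
        omega) fun i _ => rfl
    rw [e, List.append_assoc]
    exact g4

/-- The second insertion starts from the lowest entry of column `k`. It is at most the value just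
inserted there, hence below the value `y'` displaced by it, and `reverseInsert_snd_lt` applies. The
case of an equal right neighbour cannot occur: all entries left in column `k + 1` exceed the removed
one. -/
theorem snd_lt (h : CanReverse P (k + 1 + 1)) :
    (reverseHecke (reverseHecke P (P.bottomBox (k + 1)) true).1
      ((reverseHecke P (P.bottomBox (k + 1)) true).1.bottomBox k) true).2 <
      (reverseHecke P (P.bottomBox (k + 1)) true).2 := by
  obtain ⟨h1, h2, h3, h4, -, h5⟩ := h.eraseBottom_facts
  obtain ⟨hnext, -, -⟩ := h.next
  obtain ⟨c, y', hcP, hce, hlt, hmin, P₁, hcells, hP₁, hother, hlower, hle, hrec, hcase⟩ :=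
      reverseInsert_step h1 h2 h3 (h4 k rfl)
  have hs₁ : P₁.HasPartitionShape := h1.congr hcells
  have hc₁ : ∀ j, k = j + 1 → P₁.ComesFrom j y' := by
    rintro j rfl
    refine .of_step hs₁ (hcells ▸ hcP) rfl ?_ (fun i hi hb => hlower i hi (hcells ▸ hb)) hle
    rw [hother _ (by simp), ← hce]
    exact h2.2.1 _ (h1.mem hcP le_rfl (by omega)) _ hcP rfl (by simp)
  obtain ⟨f1, f2, f3, -⟩ := reverseInsert_spec k P₁ y' hs₁ hP₁ (by omega) hc₁
  rw [← hrec, ← reverseHecke_eq] at f1 f2 f3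
  set R := (reverseHecke P (P.bottomBox (k + 1)) true).1 with hR
  obtain ⟨hb, hmax⟩ := bottomBox_spec (hnext.nonempty k rfl)
  obtain ⟨d, hd⟩ : ∃ d, R.bottomBox k = (d, k) := ⟨_, rfl⟩
  rw [reverseHecke_eq R, hd]
  rw [reverseHecke_eq, hrec]
  rw [hd] at hb hmax
  have hbot : ∀ x ∈ P₁.column k, R.entry (d, k) ≤ x := by
    intro x hx
    obtain ⟨i, hi, rfl⟩ := (mem_column _ _ _).1 hx
    rw [← f1] at hi
    rw [← f3 _ le_rfl]
    exact f2.entry_le hnext.shape hb (hmax i hi) le_rfl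
  have hlt' : R.entry (d, k) < y' := by
    rcases hcase with hcase | ⟨rfl, hcase | hcase⟩
    · exact (hbot _ (by rw [hcase]; simp)).trans_lt hlt
    · exact (hbot _ hcase).trans_lt hlt
    · have := h5 _ ((mem_column _ _ _).2 ⟨c, hcase⟩)
      omega
  refine reverseInsert_snd_lt k P₁ y' _ _ d hs₁ hP₁ (by omega) hc₁ (f1 ▸ hb)
    (f3 _ le_rfl).symm hlt' ?_ ?_
  · intro i j hj
    rw [mem_eraseBottom, hd, f1]
    exact and_iff_right fun e => by have := (Prod.mk.inj e).2; omega
  · intro i j hj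
    show R.entry (i, j) = _
    rw [hR, reverseHecke_eq, hrec]

end CanReverse

/-! ### The outputs of reverse insertion and the star set -/

theorem reverseHeckeOutputs_spec : ∀ (m : ℕ) (P : Filling), P.CanReverse m →
    (∃ w, WordEquiv (P.reverseColumnsWord m) (w ++ (reverseHeckeOutputs m P).reverse)) ∧
    (reverseHeckeOutputs m P).Pairwise (· > ·) ∧ (reverseHeckeOutputs m P).length = m := by
  intro m
  induction m with
  | zero => exact fun P _ => ⟨⟨[], .refl _⟩, by simp [reverseHeckeOutputs], rfl⟩
  | succ k ih =>
    intro P h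
    obtain ⟨h1, h2, h3⟩ := h.next
    obtain ⟨⟨w, hw⟩, hp, hlen⟩ := ih _ h1
    -- The shortened columns pile up on the left of the word, the outputs on its right with the
    -- first one last; hence the reversal.
    refine ⟨⟨((CanReverse.eraseBottom P k).column k).sort (· ≥ ·) ++ w, h3.trans ?_⟩, ?_, ?_⟩
    · have := (WordEquiv.refl (((CanReverse.eraseBottom P k).column k).sort (· ≥ ·))).append
        (hw.append (.refl [(reverseHecke P (P.bottomBox k) true).2]))
      simpa [reverseHeckeOutputs] using this
    · rw [reverseHeckeOutputs]
      cases k with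
      | zero => simp [reverseHeckeOutputs]
      | succ k =>
        have hlt := h.snd_lt
        rw [reverseHeckeOutputs] at hp ⊢
        refine List.pairwise_cons.2 ⟨fun a ha => ?_, hp⟩
        rcases List.mem_cons.1 ha with rfl | ha
        · exact hlt
        · exact ((List.pairwise_cons.1 hp).1 a ha).trans hlt
    · rw [reverseHeckeOutputs]
      simpa using hlen

theorem canReverse_conjugate {T : Filling} (hs : T.HasPartitionShape) (hT : T.IsDecreasing) {m : ℕ}
    (hm : ∀ i, i < m ↔ (i, 0) ∈ T.cells) : T.conjugate.CanReverse m := by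
  refine ⟨⟨⟨T.conjugate.cells, isLowerSet_of_pred ?_ ?_⟩, rfl⟩, ⟨?_, ?_, ?_⟩, ?_, ?_⟩
  · intro i j h
    rw [mem_conjugate] at h ⊢
    exact hs.mem h le_rfl (by omega)
  · intro i j h
    rw [mem_conjugate] at h ⊢
    exact hs.mem h (by omega) le_rfl
  · rintro ⟨i, j⟩ h
    exact hT.1 _ ((mem_conjugate _ _ _).1 h)
  · rintro ⟨i, j⟩ h ⟨i', j'⟩ h' e hlt
    exact hT.2.2 _ ((mem_conjugate _ _ _).1 h) _ ((mem_conjugate _ _ _).1 h') e hlt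
  · rintro ⟨i, j⟩ h ⟨i', j'⟩ h' e hlt
    exact hT.2.1 _ ((mem_conjugate _ _ _).1 h) _ ((mem_conjugate _ _ _).1 h') e hlt
  · rintro k rfl
    exact ⟨0, (mem_conjugate _ _ _).2 ((hm k).1 (by omega))⟩
  · rintro i k rfl h
    have := (hm (k + 1)).2 (hs.mem ((mem_conjugate _ _ _).1 h) le_rfl (by omega))
    omega

/-- As for antinormal shapes: the reversed outputs are an increasing suffix of an equivalent word,
so they survive, and their number `m` is that of the rows, an upper bound for the star set. -/
theorem toFinset_reverseHeckeOutputs {T : Filling} (hs : T.HasPartitionShape) (hT : T.IsDecreasing)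
    {m : ℕ} (hm : ∀ i, i < m ↔ (i, 0) ∈ T.cells) :
    (reverseHeckeOutputs m T.conjugate).toFinset = star ∅ T.word := by
  obtain ⟨⟨w, hw⟩, hp, hlen⟩ := reverseHeckeOutputs_spec m _ (canReverse_conjugate hs hT hm)
  have hrow : ∀ b ∈ T.cells, b.1 < m := fun b hb =>
    (hm b.1).2 (hs.mem (i' := b.1) (j' := b.2) hb le_rfl (by omega))
  have hstar : star ∅ T.word = star ∅ (w ++ (reverseHeckeOutputs m T.conjugate).reverse) := by
    rw [← star_rowsList hT hs hrow, ← reverseColumnsWord_conjugate hT, hw.star_eq]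
  refine Finset.eq_of_subset_of_card_le ?_ ?_
  · intro x hx
    rw [hstar, star_append]
    exact mem_star_of_mem (List.pairwise_reverse.2 hp) (by simpa using hx)
  · rw [List.toFinset_card_of_nodup (hp.imp fun h => ne_of_gt h), hlen]
    refine (card_star_word_le hT).trans ?_
    calc (T.cells.image Prod.fst).card ≤ (Finset.range m).card :=
          Finset.card_le_card fun i hi => by
            obtain ⟨b, hb, rfl⟩ := Finset.mem_image.1 hi
            exact Finset.mem_range.2 (hrow b hb)
      _ = m := Finset.card_range m

theorem lt_card_columnCells_iff {T : Filling} (hs : T.HasPartitionShape) (i j : ℕ) :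
    i < (T.columnCells j).card ↔ (i, j) ∈ T.cells := by
  obtain ⟨μ, hμ⟩ := hs
  have : T.columnCells j = μ.col j := by
    rw [columnCells, hμ]; rfl
  rw [this, ← YoungDiagram.colLen_eq_card, ← YoungDiagram.mem_iff_lt_colLen, hμ]
  exact Iff.rfl

end Filling

theorem propositionP (T : Filling) (hshape : T.HasPartitionShape) (hdec : T.IsDecreasing) :
    -- the rightmost column of every anti-rectification
    (∀ T' : Filling, T.IsAntirectification T' →
      T'.rightmostColumn = Filling.star ∅ T.word) ∧
    -- every increasing tableau `U` of shape `R / T`, `R` the tight rectangle, anti-rectifies `T`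
    (∀ U : Filling, U.IsIncreasing →
      U.cells = Filling.boundingRectangle T.cells \ T.cells →
      T.IsAntirectification (Filling.kjdt U T)) ∧
    -- independence of the rectification order
    (∀ T' T'' : Filling, T.IsAntirectification T' → T.IsAntirectification T'' →
      T'.rightmostColumn = T''.rightmostColumn) ∧
    -- the right key is a key tableau, and the three descriptions of its columns
    T.rightKey.IsKey ∧
    ∀ j : ℕ,
      T.rightKey.column j = Filling.star ∅ (T.dropColumns j).word ∧
      (∀ T' : Filling, (T.dropColumns j).IsAntirectification T' →
        T.rightKey.column j = T'.rightmostColumn) ∧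
      T.rightKey.column j =
        (Filling.reverseHeckeOutputs (T.columnCells j).card
          (T.dropColumns j).conjugate).toFinset := by
  refine ⟨fun T' h => Filling.rightmostColumn_of_isAntirectification hdec h,
    fun U hU hUc => Filling.isAntirectification_kjdt hshape hdec hU hUc, fun T' T'' h h' => ?_,
    Filling.isKey_rightKey hdec, fun j => ⟨Filling.column_rightKey T j, fun T' h => ?_, ?_⟩⟩
  · rw [Filling.rightmostColumn_of_isAntirectification hdec h,
      Filling.rightmostColumn_of_isAntirectification hdec h']
  · rw [Filling.rightmostColumn_of_isAntirectification (hdec.dropColumns j) h]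
    exact Filling.column_rightKey T j
  · rw [Filling.toFinset_reverseHeckeOutputs (hshape.dropColumns j) (hdec.dropColumns j)]
    · exact Filling.column_rightKey T j
    · intro i
      rw [Filling.lt_card_columnCells_iff hshape, Filling.mem_dropColumns, Nat.zero_add]
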